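/- Let $n\ge 2$ and $k_1,\dots,k_n\ge 2$ be integers. Let $\Gamma_1$ be the flower obtained by gluing together $n$ cycles, the $j$-th one having $k_j+1$ vertices, at one common vertex (the root) $\mathcal O$. Let $\Gamma$ be the graph obtained from the disjoint union of $\Gamma_1$ and the one-sided infinite path $\mathbb P_\infty$ by joining the first vertex of $\mathbb P_\infty$ to $\mathcal O$ by an edge. All graphs are unweighted. Let $A(\Gamma)$ be the adjacency operator of $\Gamma$ on $\ell^2(\mathcal V(\Gamma))$; let $\sigma(\Gamma)$ denote its spectrum and $\sigma_d(\Gamma)$ its discrete spectrum, that is, the set of the isolated points of $\sigma(\Gamma)$ that are eigenvalues of finite multiplicity. Then each of the equations $$2\sum_{j=1}^n\frac{\sinh k_jt+\sinh t}{\sinh (k_j+1)t}=e^t,\qquad 2\sum_{j=1}^n\frac{\sinh k_jt+(-1)^{k_j+1}\sinh t}{\sinh (k_j+1)t}=e^t$$ has a unique solution $t>0$. If $t_+$ and $t_-$ denote the solution of the first and of the second equation, respectively, then $$\sigma(\Gamma)=[-2,2]\cup\{2\cosh t_+,\,-2\cosh t_-\},\qquad \sigma_d(\Gamma)=\{2\cosh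 t_+,\,-2\cosh t_-\};$$ in particular, the discrete spectrum consists of exactly two points. Moreover, let $P(\lambda,F)=\det(\lambda-A(F))$ be the characteristic polynomial of a finite graph $F$, and let $Q(\lambda,m)=U_m(\lambda/2)$, where $U_m$ is the Chebyshev polynomial of the second kind, and $Q(\lambda)=\prod_{j=1}^n Q(\lambda,k_j)$. Then $Q(\lambda,m)=P(\lambda,\mathbb P_m)$, where $\mathbb P_m$ is the path with $m$ vertices, $Q(\lambda)=P(\lambda,\Gamma_1\setminus\mathcal O)$, where $\Gamma_1\setminus\mathcal O$ is the graph induced by the vertices of $\Gamma_1$ other than $\mathcal O$, and $$P(\lambda,\Gamma_1)=Q(\lambda)\Bigl\{\lambda-2\sum_{j=1}^n\frac{Q(\lambda,k_j-1)+1}{Q(\lambda,k_j)}\Bigr\}$$ for all $\lambda\in\mathbb C$ with $Q(\lambda)\neq0$. -/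

import Mathlib

open scoped ENNReal

/-- The degrees of the vertices of `G` are finite and bounded. -/
def UniformlyLocallyFinite {V : Type*} (G : SimpleGraph V) : Prop :=
  ∃ D : ℕ, ∀ v, (G.neighborSet v).Finite ∧ (G.neighborSet v).ncard ≤ D

theorem UniformlyLocallyFinite.finite_neighborSet {V : Type*} {G : SimpleGraph V}
    (hG : UniformlyLocallyFinite G) (v : V) : (G.neighborSet v).Finite :=
  hG.choose_spec v |>.1

/-- The finite set of neighbours of a vertex. -/
noncomputable def UniformlyLocallyFinite.nbrs {V : Type*} {G : SimpleGraph V}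
    (hG : UniformlyLocallyFinite G) (v : V) : Finset V :=
  (hG.finite_neighborSet v).toFinset

theorem UniformlyLocallyFinite.mem_nbrs {V : Type*} {G : SimpleGraph V}
    (hG : UniformlyLocallyFinite G) (v w : V) : w ∈ hG.nbrs v ↔ G.Adj v w := by
  simp [UniformlyLocallyFinite.nbrs]

/-- A uniform bound of the degrees. -/
noncomputable def UniformlyLocallyFinite.bound {V : Type*} {G : SimpleGraph V}
    (hG : UniformlyLocallyFinite G) : ℕ := hG.choose

theorem UniformlyLocallyFinite.card_nbrs_le {V : Type*} {G : SimpleGraph V}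
    (hG : UniformlyLocallyFinite G) (v : V) : (hG.nbrs v).card ≤ hG.bound := by
  have h := (hG.choose_spec v).2
  rwa [Set.ncard_eq_toFinset_card _ (hG.finite_neighborSet v)] at h

/-- The Hilbert space `ℓ²(V)` of square summable complex functions on `V`. -/
abbrev EllTwo (V : Type*) : Type _ := lp (fun _ : V => ℂ) 2

theorem UniformlyLocallyFinite.sum_sq_le {V : Type*} {G : SimpleGraph V}
    (hG : UniformlyLocallyFinite G) (f : EllTwo V) (S : Finset V) :
    ∑ v ∈ S, ‖∑ u ∈ hG.nbrs v, f u‖ ^ (2 : ℝ≥0∞).toReal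
      ≤ (hG.bound * ‖f‖) ^ (2 : ℝ≥0∞).toReal := by
  classical
  have hf : ∀ T : Finset V, ∑ u ∈ T, ‖f u‖ ^ 2 ≤ ‖f‖ ^ 2 := by
    intro T
    have h := lp.sum_rpow_le_norm_rpow (p := 2) (by norm_num) f T
    simpa using h
  have h2 : (2 : ℝ≥0∞).toReal = ((2 : ℕ) : ℝ) := by norm_num
  simp only [h2, Real.rpow_natCast]
  set D : ℝ := (hG.bound : ℝ) with hD
  have hD0 : 0 ≤ D := Nat.cast_nonneg _
  have h1 : ∀ v, ‖∑ u ∈ hG.nbrs v, f u‖ ^ 2 ≤ D * ∑ u ∈ hG.nbrs v, ‖f u‖ ^ 2 := by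
    intro v
    calc ‖∑ u ∈ hG.nbrs v, f u‖ ^ 2 ≤ (∑ u ∈ hG.nbrs v, ‖f u‖) ^ 2 := by
          gcongr
          exact norm_sum_le _ _
      _ ≤ (hG.nbrs v).card * ∑ u ∈ hG.nbrs v, ‖f u‖ ^ 2 := sq_sum_le_card_mul_sum_sq
      _ ≤ D * ∑ u ∈ hG.nbrs v, ‖f u‖ ^ 2 := by
          gcongr
          exact Nat.cast_le.2 (hG.card_nbrs_le v)
  have h3 : ∑ v ∈ S, ∑ u ∈ hG.nbrs v, ‖f u‖ ^ 2 ≤ D * ‖f‖ ^ 2 := by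
    calc ∑ v ∈ S, ∑ u ∈ hG.nbrs v, ‖f u‖ ^ 2
        = ∑ u ∈ S.biUnion hG.nbrs, ∑ v ∈ S with u ∈ hG.nbrs v, ‖f u‖ ^ 2 := by
          refine Finset.sum_comm' fun v u => ?_
          simp only [Finset.mem_filter, Finset.mem_biUnion]
          exact ⟨fun h => ⟨h, v, h⟩, fun h => h.1⟩
      _ ≤ ∑ u ∈ S.biUnion hG.nbrs, D * ‖f u‖ ^ 2 := by
          refine Finset.sum_le_sum fun u _ => ?_
          rw [Finset.sum_const, nsmul_eq_mul]
          gcongr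
          refine le_trans ?_ (Nat.cast_le.2 (hG.card_nbrs_le u))
          refine Nat.cast_le.2 (Finset.card_le_card fun v hv => ?_)
          rw [Finset.mem_filter, hG.mem_nbrs] at hv
          exact (hG.mem_nbrs _ _).2 hv.2.symm
      _ = D * ∑ u ∈ S.biUnion hG.nbrs, ‖f u‖ ^ 2 := by rw [Finset.mul_sum]
      _ ≤ D * ‖f‖ ^ 2 := by
          gcongr
          exact hf _
  calc ∑ v ∈ S, ‖∑ u ∈ hG.nbrs v, f u‖ ^ 2
      ≤ ∑ v ∈ S, D * ∑ u ∈ hG.nbrs v, ‖f u‖ ^ 2 := Finset.sum_le_sum fun v _ => h1 v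
    _ = D * ∑ v ∈ S, ∑ u ∈ hG.nbrs v, ‖f u‖ ^ 2 := by rw [Finset.mul_sum]
    _ ≤ D * (D * ‖f‖ ^ 2) := by gcongr
    _ = (D * ‖f‖) ^ 2 := by ring

/-- The adjacency operator on `ℓ²(V)` of a uniformly locally finite graph:
`(A f)(v)` is the sum of `f u` over the neighbours `u` of `v`. -/
noncomputable def adjacencyOperator {V : Type*} (G : SimpleGraph V)
    (hG : UniformlyLocallyFinite G) : EllTwo V →L[ℂ] EllTwo V :=
  LinearMap.mkContinuous
    { toFun := fun f => ⟨fun v => ∑ u ∈ hG.nbrs v, f u, memℓp_gen' (hG.sum_sq_le f)⟩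
      map_add' := fun f g => by
        ext v
        exact Finset.sum_add_distrib
      map_smul' := fun c f => by
        ext v
        simp [Finset.mul_sum] }
    hG.bound
    (fun f => lp.norm_le_of_forall_sum_le (by norm_num) (by positivity) (hG.sum_sq_le f))

/-- The discrete spectrum: the isolated points of the spectrum that are eigenvalues of finite
multiplicity. -/
def discreteSpectrum {H : Type*} [NormedAddCommGroup H] [NormedSpace ℂ H] (A : H →L[ℂ] H) :
    Set ℂ :=
  {z | (∃ ε > 0, ∀ w ∈ spectrum ℂ A, dist w z < ε → w = z) ∧
    Module.End.HasEigenvalue (A : Module.End ℂ H) z ∧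
    FiniteDimensional ℂ (Module.End.eigenspace (A : Module.End ℂ H) z)}

/-- The coupling of two graphs: their disjoint union with one more edge (the bridge) joining
`v₁` and `v₂`. -/
def coupling {V₁ V₂ : Type*} (G₁ : SimpleGraph V₁) (G₂ : SimpleGraph V₂) (v₁ : V₁) (v₂ : V₂) :
    SimpleGraph (V₁ ⊕ V₂) :=
  (G₁ ⊕g G₂) ⊔ SimpleGraph.edge (Sum.inl v₁) (Sum.inr v₂)

/-- The one-sided infinite path `0 - 1 - 2 - ⋯`. -/
def infinitePath : SimpleGraph ℕ := SimpleGraph.hasse ℕ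

/-- The vertices of the flower: the common root `none`, and `k j` further vertices on the petal
number `j`. -/
abbrev FlowerVertex {n : ℕ} (k : Fin n → ℕ) : Type := Option (Σ j : Fin n, Fin (k j))

/-- The inclusion of the vertices of the `j`-th cycle; the vertex `0` goes to the root and
`i + 1` goes to the vertex number `i` of the petal. -/
def petalEmbedding {n : ℕ} (k : Fin n → ℕ) (j : Fin n) : Fin (k j + 1) ↪ FlowerVertex k :=
  (finSuccEquiv (k j)).toEmbedding.trans
    (Function.Embedding.sigmaMk (β := fun j : Fin n => Fin (k j)) j).optionMap

/-- The flower: cycles with `k j + 1` vertices glued together at one common vertex. -/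
def flower {n : ℕ} (k : Fin n → ℕ) : SimpleGraph (FlowerVertex k) :=
  ⨆ j : Fin n, (SimpleGraph.cycleGraph (k j + 1)).map (petalEmbedding k j)

/-- The flower with the infinite path attached to its root. -/
def flowerWithTail {n : ℕ} (k : Fin n → ℕ) : SimpleGraph (FlowerVertex k ⊕ ℕ) :=
  coupling (flower k) infinitePath none 0

theorem flowerWithTail_uniformlyLocallyFinite {n : ℕ} (k : Fin n → ℕ) :
    UniformlyLocallyFinite (flowerWithTail k) := by
  classical
  have key : ∀ v, ∃ s : Finset (FlowerVertex k ⊕ ℕ), s.card ≤ Fintype.card (FlowerVertex k) + 3 ∧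
      (flowerWithTail k).neighborSet v ⊆ s := by
    rintro (v | m)
    · refine ⟨insert (Sum.inr 0) (Finset.univ.image Sum.inl), ?_, ?_⟩
      · refine (Finset.card_insert_le _ _).trans ?_
        have := Finset.card_image_le (s := (Finset.univ : Finset (FlowerVertex k)))
          (f := (Sum.inl : _ → FlowerVertex k ⊕ ℕ))
        rw [Finset.card_univ] at this
        omega
      · rintro (w | m) h
        · simp
        · simp [flowerWithTail, coupling, SimpleGraph.edge_adj] at h
          simp [h]
    · refine ⟨{Sum.inl none, Sum.inr (m + 1), Sum.inr (m - 1)}, ?_, ?_⟩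
      · exact Finset.card_le_three.trans (by omega)
      · rintro (w | l) h
        · simp [flowerWithTail, coupling, SimpleGraph.edge_adj] at h
          simp [h]
        · simp [flowerWithTail, coupling, infinitePath, SimpleGraph.edge_adj,
            SimpleGraph.hasse_adj, Order.covBy_iff_add_one_eq] at h
          simp
          omega
  refine ⟨Fintype.card (FlowerVertex k) + 3, fun v => ?_⟩
  obtain ⟨s, hs, hsub⟩ := key v
  refine ⟨s.finite_toSet.subset hsub, ?_⟩
  refine (Set.ncard_le_ncard hsub s.finite_toSet).trans ?_
  rwa [Set.ncard_coe_finset]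

/-- The adjacency operator of the flower with the infinite tail. -/
noncomputable def flowerOperator {n : ℕ} (k : Fin n → ℕ) :
    EllTwo (FlowerVertex k ⊕ ℕ) →L[ℂ] EllTwo (FlowerVertex k ⊕ ℕ) :=
  adjacencyOperator (flowerWithTail k) (flowerWithTail_uniformlyLocallyFinite k)

open Classical in
/-- The characteristic polynomial `det (z - A(F))` of a finite graph `F`. -/
noncomputable def graphCharpoly {V : Type*} [Fintype V] (F : SimpleGraph V) : Polynomial ℂ :=
  (F.adjMatrix ℂ).charpoly

/-- `Q(z, m) = U_m(z / 2)`, with the Chebyshev polynomials of the second kind. -/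
noncomputable def chebQ (z : ℂ) (m : ℕ) : ℂ := (Polynomial.Chebyshev.U ℂ (m : ℤ)).eval (z / 2)

/-! ### The secular equation in the variable `x = e⁻ᵗ` -/

/-! Write an eigenvalue as `w + w⁻¹` with `0 < ‖w‖ < 1`. On the tail a square summable solution must
be a multiple of `w ^ m`. On a petal with `K` inner vertices and root value `c` at both ends, the
only solution is `c (w ^ m + w ^ (K + 1 - m)) / (1 + w ^ (K + 1))`. What remains is the equation at
the root, which becomes `2 * ∑ j, (1 - (1 - w ^ 2) / (1 + w ^ (k j + 1))) = 1`
(`flowerOperator_eigenvector_iff`). For `w = ±exp (-t)` these are the two hyperbolic equations. In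
`x = exp (-t)` their left side strictly increases on `(0, 1)` from the limit `0` at `0` to values
above `1`, so each has one root.

The operator differs by finite rank from that of a path with isolated vertices, whose norm is at
most `2`. Hence outside the disc of radius `2` a spectral point is an eigenvalue
(`isUnit_sub_flowerOperator`), and self-adjointness makes it real. Truncated plane waves on the tail
put all of `[-2, 2]` in the spectrum (`mem_spectrum_of_norm_eq_one`). Eigenvalues inside `[-2, 2]`,
such as sine waves on a petal vanishing at the root, are not isolated and do not enter the discrete
spectrum.

The characteristic polynomial of the flower is a Schur complement at the root (`det_bordered`): the
block off the root is a direct sum of path matrices, whose determinants obey the Chebyshev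
recurrence, and the linear system on each petal is solved explicitly. -/

theorem exp_neg_mul_sinh_ratio (k : ℕ) (hk : 2 ≤ k) {e t : ℝ} (he : e = 1 ∨ e = -1) (ht : 0 < t) :
    Real.exp (-t) * ((Real.sinh (k * t) + e * Real.sinh t) / Real.sinh ((k + 1) * t)) =
      1 - (1 - Real.exp (-t) ^ 2) / (1 + e * Real.exp (-t) ^ (k + 1)) := by
  set x := Real.exp (-t) with hx
  have hx0 : 0 < x := Real.exp_pos _
  have hx1 : x < 1 := Real.exp_lt_one_iff.2 (by linarith)
  have hy1 : x ^ (k + 1) < 1 := pow_lt_one₀ hx0.le hx1 (by omega)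
  have hy0 : 0 < x ^ (k + 1) := pow_pos hx0 _
  have e1 : Real.exp t = x⁻¹ := by rw [hx, Real.exp_neg, inv_inv]
  have ek : ∀ m : ℕ, Real.sinh (m * t) = ((x ^ m)⁻¹ - x ^ m) / 2 := by
    intro m
    rw [Real.sinh_eq, ← mul_neg, Real.exp_nat_mul, Real.exp_nat_mul, e1, inv_pow]
  have h1 := ek 1
  have h2 := ek (k + 1)
  push_cast at h1 h2
  rw [one_mul, pow_one] at h1
  rw [ek k, h1, h2]
  have hd1 : (x ^ (k + 1))⁻¹ - x ^ (k + 1) ≠ 0 := by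
    have : 1 < (x ^ (k + 1))⁻¹ := (one_lt_inv₀ hy0).2 hy1
    exact ne_of_gt (by linarith)
  have hd2 : 1 + e * x ^ (k + 1) ≠ 0 := by
    rcases he with rfl | rfl <;> exact ne_of_gt (by linarith)
  have hxk : x ^ k ≠ 0 := (pow_pos hx0 _).ne'
  have hd3 : 1 - x ^ (k + 1) * x ^ (k + 1) ≠ 0 := ne_of_gt (by nlinarith)
  -- `e * e = 1` gives `1 - Y ^ 2 = (1 - e Y) (1 + e Y)` for `Y = x ^ (k + 1)`; the first factor
  -- cancels against the numerator.
  have hee : e * e = 1 := by rcases he with rfl | rfl <;> norm_num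
  have hd1' : (x ^ (k + 1))⁻¹ - x ^ (k + 1) = (1 - x ^ (k + 1) * x ^ (k + 1)) / x ^ (k + 1) := by
    field_simp
  rw [hd1']
  rw [pow_succ] at hd2 hd3 ⊢
  generalize x ^ k = y at *
  generalize hD : 1 + e * (y * x) = D at *
  generalize hE : 1 - y * x * (y * x) = E at *
  field_simp
  subst hD hE
  linear_combination (x ^ 2 * y ^ 2) * (1 - x ^ 2) * hee

/-- The secular function in the variable `x = e⁻ᵗ`, with signs `e j`. -/
noncomputable def secular {n : ℕ} (k : Fin n → ℕ) (e : Fin n → ℝ) (x : ℝ) : ℝ :=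
  2 * ∑ j, (1 - (1 - x ^ 2) / (1 + e j * x ^ (k j + 1)))

theorem secular_eq_iff {n : ℕ} (k : Fin n → ℕ) (hk : ∀ j, 2 ≤ k j) (e : Fin n → ℝ)
    (he : ∀ j, e j = 1 ∨ e j = -1) {t : ℝ} (ht : 0 < t) :
    2 * ∑ j, (Real.sinh (k j * t) + e j * Real.sinh t) / Real.sinh ((k j + 1) * t) = Real.exp t ↔
      secular k e (Real.exp (-t)) = 1 := by
  have h : secular k e (Real.exp (-t)) = Real.exp (-t) *
      (2 * ∑ j, (Real.sinh (k j * t) + e j * Real.sinh t) / Real.sinh ((k j + 1) * t)) := by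
    rw [secular, mul_left_comm (Real.exp _), Finset.mul_sum _ _ (Real.exp _)]
    exact congrArg _ (Finset.sum_congr rfl fun j _ =>
      (exp_neg_mul_sinh_ratio (k j) (hk j) (he j) ht).symm)
  rw [h, Real.exp_neg, inv_mul_eq_one₀ (Real.exp_pos t).ne', eq_comm]

theorem one_add_sign_mul_pow_pos {e x : ℝ} (he : e = 1 ∨ e = -1) (hx0 : 0 ≤ x) (hx1 : x < 1)
    (m : ℕ) : 0 < 1 + e * x ^ (m + 1) := by
  have h1 : x ^ (m + 1) < 1 := pow_lt_one₀ hx0 hx1 (by omega)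
  have h0 : 0 ≤ x ^ (m + 1) := pow_nonneg hx0 _
  rcases he with rfl | rfl <;> linarith

/-- Numerator and denominator both decrease, so the monotonicity is read off the reciprocal, `1 + ∑
u ^ (i + 1) * (u / (1 + u))`. Its sum has `k - 1 ≥ 1` increasing terms. Writing `u / (1 + u)` as `1
- (1 + u)⁻¹` makes each term visibly monotone. -/
theorem div_one_sub_pow_lt {x y : ℝ} (hx0 : 0 < x) (hxy : x < y) (hy1 : y < 1) (k : ℕ)
    (hk : 2 ≤ k) : (1 - y ^ 2) / (1 - y ^ (k + 1)) < (1 - x ^ 2) / (1 - x ^ (k + 1)) := by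
  have key : ∀ u : ℝ, 0 < u → u < 1 → (1 - u ^ 2) / (1 - u ^ (k + 1)) =
      (1 + ∑ i ∈ Finset.range (k - 1), u ^ (i + 1) * (1 - (1 + u)⁻¹))⁻¹ := by
    intro u hu0 hu1
    obtain ⟨m, rfl⟩ : ∃ m, k = m + 1 := ⟨k - 1, by omega⟩
    have hs : 1 - u ^ (m + 1 + 1) =
        (1 - u ^ 2) * (1 + ∑ i ∈ Finset.range m, u ^ (i + 1) * (1 - (1 + u)⁻¹)) := by
      clear hk
      induction m with
      | zero => simp
      | succ m ih =>
        rw [Finset.sum_range_succ, ← add_assoc, mul_add, ← ih]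
        have : 1 + u ≠ 0 := by positivity
        field_simp
        ring
    have h2 : 1 - u ^ 2 ≠ 0 := ne_of_gt (by nlinarith)
    rw [hs, Nat.add_sub_cancel, div_mul_eq_div_div, div_self h2, one_div]
  rw [key x hx0 (hxy.trans hy1), key y (hx0.trans hxy) hy1]
  have hpos : ∀ u : ℝ, 0 < u → 0 < 1 - (1 + u)⁻¹ := fun u hu => by
    have : (1 + u)⁻¹ < 1 := inv_lt_one_of_one_lt₀ (by linarith)
    linarith
  have hne : (Finset.range (k - 1)).Nonempty := Finset.nonempty_range_iff.2 (by omega)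
  refine inv_strictAnti₀ ?_ ?_
  · have := Finset.sum_nonneg (s := Finset.range (k - 1))
      (f := fun i => x ^ (i + 1) * (1 - (1 + x)⁻¹))
      (fun i _ => mul_nonneg (pow_nonneg hx0.le _) (hpos x hx0).le)
    linarith
  · gcongr with i hi
    · exact (hpos x hx0).le

theorem secular_strictMonoOn {n : ℕ} (hn : 2 ≤ n) (k : Fin n → ℕ) (hk : ∀ j, 2 ≤ k j)
    (e : Fin n → ℝ) (he : ∀ j, e j = 1 ∨ e j = -1) :
    StrictMonoOn (secular k e) (Set.Ioo 0 1) := by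
  intro x hx y hy hxy
  have : Nonempty (Fin n) := ⟨⟨0, by omega⟩⟩
  unfold secular
  refine mul_lt_mul_of_pos_left
    (Finset.sum_lt_sum_of_nonempty Finset.univ_nonempty fun j _ => ?_) two_pos
  refine sub_lt_sub_left ?_ 1
  rcases he j with h | h
  · have h1 : x ^ 2 < y ^ 2 := by nlinarith [hx.1]
    have h2 : y ^ 2 < 1 := by nlinarith [hy.1, hy.2]
    rw [h, one_mul, one_mul]
    have h3 : x ^ (k j + 1) < y ^ (k j + 1) := pow_lt_pow_left₀ hxy hx.1.le (by omega)
    exact div_lt_div₀ (by linarith) (by linarith) (by linarith)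
      (by have := pow_pos hx.1 (k j + 1); linarith)
  · simpa only [h, neg_one_mul, ← sub_eq_add_neg] using
      div_one_sub_pow_lt hx.1 hxy hy.2 (k j) (hk j)

theorem exists_secular_eq_one {n : ℕ} (hn : 2 ≤ n) (k : Fin n → ℕ) (hk : ∀ j, 2 ≤ k j)
    (e : Fin n → ℝ) (he : ∀ j, e j = 1 ∨ e j = -1) :
    ∃ x ∈ Set.Ioo (0 : ℝ) 1, secular k e x = 1 := by
  have hcont : ContinuousOn (secular k e) (Set.Icc 0 (9 / 10)) := by
    unfold secular
    refine continuousOn_const.mul (continuousOn_finsetSum _ fun j _ => ?_)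
    refine continuousOn_const.sub (ContinuousOn.div (by fun_prop) (by fun_prop) fun x hx => ?_)
    exact (one_add_sign_mul_pow_pos (he j) hx.1 (by linarith [hx.2]) _).ne'
  have h0 : secular k e 0 = 0 := by simp [secular]
  have h1 : 1 < secular k e (9 / 10) := by
    -- The interval stops at `9 / 10` because the denominator vanishes at `1` when the sign is `-1`.
    -- With `k j ≥ 2` the power is at most `(9 / 10) ^ 3`, which gives `27 / 100` for either sign;
    -- `n ≥ 2` then gives a total of at least `1.08`.
    have hj : ∀ j, (27 / 100 : ℝ) ≤
        1 - (1 - (9 / 10 : ℝ) ^ 2) / (1 + e j * (9 / 10 : ℝ) ^ (k j + 1)) := by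
      intro j
      have hp := one_add_sign_mul_pow_pos (he j) (x := 9 / 10) (by norm_num) (by norm_num) (k j)
      have hy0 : (0 : ℝ) < (9 / 10) ^ (k j + 1) := by positivity
      have hy : (9 / 10 : ℝ) ^ (k j + 1) ≤ (9 / 10) ^ 3 :=
        pow_le_pow_of_le_one (by norm_num) (by norm_num) (by have := hk j; omega)
      rw [le_sub_comm, div_le_iff₀ hp]
      rcases he j with h | h <;> rw [h] <;> linarith
    have hs := Finset.card_nsmul_le_sum Finset.univ _ _ fun j _ => hj j
    rw [Finset.card_univ, Fintype.card_fin, nsmul_eq_mul] at hs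
    have hn' : (2 : ℝ) ≤ n := by exact_mod_cast hn
    unfold secular
    linarith
  obtain ⟨x, hx, hx1⟩ := intermediate_value_Icc (by norm_num) hcont
    (show (1 : ℝ) ∈ Set.Icc _ _ from ⟨by rw [h0]; norm_num, h1.le⟩)
  refine ⟨x, ⟨lt_of_le_of_ne hx.1 ?_, by linarith [hx.2]⟩, hx1⟩
  rintro rfl
  rw [h0] at hx1
  norm_num at hx1

theorem existsUnique_sinh_equation {n : ℕ} (hn : 2 ≤ n) (k : Fin n → ℕ) (hk : ∀ j, 2 ≤ k j)
    (e : Fin n → ℝ) (he : ∀ j, e j = 1 ∨ e j = -1) :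
    ∃! t : ℝ, 0 < t ∧
      2 * ∑ j, (Real.sinh (k j * t) + e j * Real.sinh t) / Real.sinh ((k j + 1) * t) =
        Real.exp t := by
  have hI : ∀ t : ℝ, 0 < t → Real.exp (-t) ∈ Set.Ioo (0 : ℝ) 1 := fun t ht =>
    ⟨Real.exp_pos _, Real.exp_lt_one_iff.2 (by linarith)⟩
  obtain ⟨x, hx, hx1⟩ := exists_secular_eq_one hn k hk e he
  have ht : 0 < -Real.log x := neg_pos.2 (Real.log_neg hx.1 hx.2)
  refine ⟨-Real.log x, ⟨ht, ?_⟩, ?_⟩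
  · rw [secular_eq_iff k hk e he ht, neg_neg, Real.exp_log hx.1, hx1]
  · rintro s ⟨hs, hs1⟩
    rw [secular_eq_iff k hk e he hs] at hs1
    rw [← (secular_strictMonoOn hn k hk e he).injOn (hI s hs) hx (hs1.trans hx1.symm),
      Real.log_exp, neg_neg]

/-! ### Adjacency in the flower -/

theorem cycleGraph_adj_iff_val {K : ℕ} (hK : 2 ≤ K) (a b : Fin (K + 1)) :
    (SimpleGraph.cycleGraph (K + 1)).Adj a b ↔ a.val + 1 = b.val ∨ b.val + 1 = a.val ∨
      (a.val = 0 ∧ b.val = K) ∨ (a.val = K ∧ b.val = 0) := by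
  rw [SimpleGraph.cycleGraph_adj', Fin.val_sub, Fin.val_sub]
  have ha := a.isLt
  have hb := b.isLt
  have h : ∀ u v : ℕ, u < K + 1 → v < K + 1 →
      ((K + 1 - v + u) % (K + 1) = 1 ↔ v + 1 = u ∨ (u = 0 ∧ v = K)) := by
    intro u v hu hv
    rcases lt_or_ge u v with h | h
    · rw [Nat.mod_eq_of_lt (by omega)]; omega
    · rw [show K + 1 - v + u = (u - v) + (K + 1) by omega, Nat.add_mod_right,
        Nat.mod_eq_of_lt (by omega)]
      omega
  rw [h _ _ ha hb, h _ _ hb ha]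
  tauto

theorem flower_adj_some_some {n : ℕ} {k : Fin n → ℕ} (hk : ∀ j, 2 ≤ k j) (p q : Σ j, Fin (k j)) :
    (flower k).Adj (some p) (some q) ↔
      p.1 = q.1 ∧ (p.2.val + 1 = q.2.val ∨ q.2.val + 1 = p.2.val) := by
  simp only [flower, SimpleGraph.iSup_adj, SimpleGraph.map_adj]
  constructor
  · rintro ⟨j, a, b, hab, ha, hb⟩
    rw [cycleGraph_adj_iff_val (hk j)] at hab
    induction a using Fin.cases with
    | zero => simp [petalEmbedding] at ha
    | succ a =>
      induction b using Fin.cases with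
      | zero => simp [petalEmbedding] at hb
      | succ b =>
        simp only [petalEmbedding, Function.Embedding.trans_apply, Equiv.coe_toEmbedding,
          finSuccEquiv_succ, Function.Embedding.optionMap_apply, Option.map_some,
          Option.some.injEq] at ha hb
        subst ha hb
        simp only [Fin.val_succ] at hab
        refine ⟨rfl, ?_⟩
        have := a.isLt
        have := b.isLt
        change a.val + 1 = b.val ∨ b.val + 1 = a.val
        omega
  · obtain ⟨j, a⟩ := p
    obtain ⟨j', b⟩ := q
    rintro ⟨rfl, h⟩
    refine ⟨j, a.succ, b.succ, ?_, by simp [petalEmbedding], by simp [petalEmbedding]⟩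
    rw [cycleGraph_adj_iff_val (hk j)]
    simp only [Fin.val_succ]
    simp only at h
    omega

theorem flower_adj_none_some {n : ℕ} {k : Fin n → ℕ} (hk : ∀ j, 2 ≤ k j) (p : Σ j, Fin (k j)) :
    (flower k).Adj none (some p) ↔ p.2.val = 0 ∨ p.2.val + 1 = k p.1 := by
  simp only [flower, SimpleGraph.iSup_adj, SimpleGraph.map_adj]
  constructor
  · rintro ⟨j, a, b, hab, ha, hb⟩
    rw [cycleGraph_adj_iff_val (hk j)] at hab
    induction a using Fin.cases with
    | succ a => simp [petalEmbedding] at ha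
    | zero =>
      induction b using Fin.cases with
      | zero => simp [petalEmbedding] at hb
      | succ b =>
        simp only [petalEmbedding, Function.Embedding.trans_apply, Equiv.coe_toEmbedding,
          finSuccEquiv_succ, Function.Embedding.optionMap_apply, Option.map_some,
          Option.some.injEq] at hb
        subst hb
        simp only [Fin.val_succ, Fin.val_zero] at hab
        change b.val = 0 ∨ b.val + 1 = k j
        have := b.isLt
        omega
  · obtain ⟨j, b⟩ := p
    intro h
    refine ⟨j, 0, b.succ, ?_, by simp [petalEmbedding], by simp [petalEmbedding]⟩
    rw [cycleGraph_adj_iff_val (hk j)]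
    simp only [Fin.val_succ, Fin.val_zero, true_and]
    change b.val = 0 ∨ b.val + 1 = k j at h
    omega

/-- Vertex `i` carries the number `i + 1`, leaving `0` and `K + 1` for the two places where the
petal meets the root. The determinants and the operator both use this numbering. -/
theorem sum_path_neighbors {K : ℕ} (h : ℕ → ℂ) (i : Fin K) :
    (∑ i' : Fin K, if i.val + 1 = i'.val ∨ i'.val + 1 = i.val then h (i'.val + 1) else 0) =
      (if 0 < i.val then h i.val else 0) + (if i.val + 1 < K then h (i.val + 2) else 0) := by
  have hsplit : ∀ i' : Fin K,
      (if i.val + 1 = i'.val ∨ i'.val + 1 = i.val then h (i'.val + 1) else 0) =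
        (if i'.val + 1 = i.val then h (i'.val + 1) else 0) +
          (if i'.val = i.val + 1 then h (i'.val + 1) else 0) := by
    intro i'
    by_cases h1 : i'.val + 1 = i.val
    · have h2 : ¬ i'.val = i.val + 1 := by omega
      simp [h1, h2]
    · by_cases h2 : i'.val = i.val + 1
      · have h3 : ¬ i.val + 1 + 1 = i.val := by omega
        simp [h2, h3]
      · simp [h1, h2, Ne.symm h2]
  rw [Finset.sum_congr rfl fun i' _ => hsplit i', Finset.sum_add_distrib]
  congr 1
  · split_ifs with hi
    · rw [Finset.sum_eq_single (⟨i.val - 1, by omega⟩ : Fin K)]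
      · have : i.val - 1 + 1 = i.val := by omega
        simp [this]
      · intro b _ hb
        refine if_neg fun hb' => hb (Fin.ext ?_)
        simp only
        omega
      · simp
    · refine Finset.sum_eq_zero fun b _ => if_neg ?_
      omega
  · split_ifs with hi
    · rw [Finset.sum_eq_single (⟨i.val + 1, hi⟩ : Fin K)]
      · simp
      · intro b _ hb
        exact if_neg fun hb' => hb (Fin.ext hb')
      · simp
    · refine Finset.sum_eq_zero fun b _ => if_neg ?_
      have := b.isLt
      omega

theorem sum_path_ends {K : ℕ} (hK : 2 ≤ K) (h : ℕ → ℂ) :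
    (∑ i : Fin K, if i.val = 0 ∨ i.val + 1 = K then h (i.val + 1) else 0) = h 1 + h K := by
  rw [Finset.sum_eq_add (⟨0, by omega⟩ : Fin K) ⟨K - 1, by omega⟩]
  · have : K - 1 + 1 = K := by omega
    simp [this]
  · simp [Fin.ext_iff]
    omega
  · rintro c - ⟨h1, h2⟩
    refine if_neg ?_
    simp only [ne_eq, Fin.ext_iff] at h1 h2
    omega
  · simp
  · simp

/-! ### Characteristic polynomials -/

theorem chebQ_zero (z : ℂ) : chebQ z 0 = 1 := by simp [chebQ]

theorem chebQ_one (z : ℂ) : chebQ z 1 = z := by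
  simp [chebQ, mul_div_cancel₀]

theorem chebQ_add_two (z : ℂ) (m : ℕ) : chebQ z (m + 2) = z * chebQ z (m + 1) - chebQ z m := by
  simp only [chebQ, Nat.cast_add, Nat.cast_ofNat, Nat.cast_one, Polynomial.Chebyshev.U_add_two,
    Polynomial.eval_sub, Polynomial.eval_mul, Polynomial.eval_ofNat, Polynomial.eval_X]
  ring

/-- The matrix `z - A` of the path with `m` vertices. -/
def pathMatrix (z : ℂ) (m : ℕ) : Matrix (Fin m) (Fin m) ℂ :=
  Matrix.of fun i j => (if i = j then z else 0) -
    (if i.val + 1 = j.val ∨ j.val + 1 = i.val then 1 else 0)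

theorem det_pathMatrix_add_two (z : ℂ) (m : ℕ) :
    (pathMatrix z (m + 2)).det = z * (pathMatrix z (m + 1)).det - (pathMatrix z m).det := by
  rw [Matrix.det_succ_row_zero, Fin.sum_univ_succ, Fin.sum_univ_succ]
  -- The first row has only the entries `z` and `-1`. The minor of `-1` has a single nonzero entry
  -- in its first column, so one more expansion reaches the path with `m` vertices.
  rw [Finset.sum_eq_zero (s := Finset.univ) fun i _ => ?_]
  · have h0 : (pathMatrix z (m + 2)).submatrix Fin.succ (Fin.succAbove 0) =
        pathMatrix z (m + 1) := by
      ext i j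
      simp [pathMatrix]
    have h1 : ((pathMatrix z (m + 2)).submatrix Fin.succ (Fin.succAbove (Fin.succ 0))).det =
        -(pathMatrix z m).det := by
      rw [Matrix.det_succ_column_zero, Fin.sum_univ_succ]
      rw [Finset.sum_eq_zero (s := Finset.univ) fun i _ => ?_]
      · have h2 : ((pathMatrix z (m + 2)).submatrix Fin.succ
            (Fin.succAbove (Fin.succ 0))).submatrix (Fin.succAbove 0) Fin.succ =
            pathMatrix z m := by
          ext i j
          simp [pathMatrix, Fin.succAbove, Fin.lt_def, Fin.ext_iff]
        rw [h2]
        simp [pathMatrix, Fin.succAbove]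
      · simp [pathMatrix, Fin.succAbove, Fin.ext_iff]
    rw [h0, h1]
    simp [pathMatrix]
    ring
  · simp [pathMatrix, Fin.ext_iff]

theorem det_pathMatrix (z : ℂ) (m : ℕ) : (pathMatrix z m).det = chebQ z m := by
  induction m using Nat.twoStepInduction with
  | zero => simp [chebQ_zero]
  | one => simp [chebQ_one, pathMatrix]
  | more m h1 h2 => rw [det_pathMatrix_add_two, h1, h2, chebQ_add_two]

theorem graphCharpoly_eval {V : Type*} [Fintype V] [DecidableEq V] (F : SimpleGraph V)
    [DecidableRel F.Adj] (z : ℂ) :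
    (graphCharpoly F).eval z = (Matrix.scalar V z - F.adjMatrix ℂ).det := by
  rw [← Matrix.eval_charpoly, graphCharpoly]
  congr!

theorem graphCharpoly_pathGraph_eval (m : ℕ) (z : ℂ) :
    (graphCharpoly (SimpleGraph.pathGraph m)).eval z = chebQ z m := by
  classical
  rw [graphCharpoly_eval, ← det_pathMatrix]
  congr 1
  ext i j
  simp [pathMatrix, SimpleGraph.adjMatrix_apply, SimpleGraph.pathGraph_adj, Matrix.diagonal_apply]

/-- Right multiplication by a unipotent matrix with column `-v` clears the border column and leaves
the Schur complement in the corner. Using a solution `v` of the linear system avoids inverting the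
block. -/
theorem det_bordered {α : Type*} [Fintype α] [DecidableEq α]
    (M : Matrix (Option α) (Option α) ℂ) (v : α → ℂ)
    (hv : (M.submatrix some some).mulVec v = fun a => M (some a) none) :
    M.det = (M.submatrix some some).det * (M none none - ∑ a, M none (some a) * v a) := by
  have h1 : M.det = (Matrix.fromBlocks (M.submatrix some some)
      (Matrix.of fun a (_ : Unit) => M (some a) none) (Matrix.of fun (_ : Unit) a => M none (some a))
      (Matrix.of fun (_ : Unit) (_ : Unit) => M none none)).det := by
    rw [← Matrix.det_submatrix_equiv_self (Equiv.optionEquivSumPUnit α).symm M]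
    congr 1
    ext (i | i) (j | j) <;> rfl
  have h2 := Matrix.det_mul (Matrix.fromBlocks (M.submatrix some some)
      (Matrix.of fun a (_ : Unit) => M (some a) none) (Matrix.of fun (_ : Unit) a => M none (some a))
      (Matrix.of fun (_ : Unit) (_ : Unit) => M none none))
      (Matrix.fromBlocks 1 (Matrix.of fun a (_ : Unit) => -v a) 0 1)
  rw [Matrix.fromBlocks_multiply, Matrix.det_fromBlocks_zero₂₁, Matrix.det_one, Matrix.det_one,
    one_mul, ← h1] at h2
  have h3 : (M.submatrix some some) * (Matrix.of fun a (_ : Unit) => -v a) +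
      (Matrix.of fun a (_ : Unit) => M (some a) none) * (1 : Matrix Unit Unit ℂ) = 0 := by
    ext i j
    have := congrFun hv i
    simp only [Matrix.mulVec, dotProduct] at this
    simp [Matrix.mul_apply, ← this]
  rw [h3, Matrix.det_fromBlocks_zero₁₂] at h2
  rw [← mul_one M.det, ← h2]
  congr 1
  · simp
  · simp [Matrix.mul_apply]
    ring

/-- A solution of the three-term recurrence is annihilated except at the end vertices, where the
missing neighbours leave the boundary values. This solves the petal system for the border column. -/
theorem sum_pathMatrix_mul (z : ℂ) {K : ℕ} (h : ℕ → ℂ)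
    (hrec : ∀ m < K, z * h (m + 1) = h m + h (m + 2)) (i : Fin K) :
    ∑ i', pathMatrix z K i i' * h (i'.val + 1) =
      (if i.val = 0 then h 0 else 0) + (if i.val + 1 = K then h (K + 1) else 0) := by
  have h1 : ∀ i' : Fin K, pathMatrix z K i i' * h (i'.val + 1) =
      (if i = i' then z * h (i'.val + 1) else 0) -
        (if i.val + 1 = i'.val ∨ i'.val + 1 = i.val then h (i'.val + 1) else 0) := by
    intro i'
    simp only [pathMatrix, Matrix.of_apply, sub_mul, ite_mul, zero_mul, one_mul]
  rw [Finset.sum_congr rfl fun i' _ => h1 i', Finset.sum_sub_distrib, sum_path_neighbors,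
    Finset.sum_ite_eq, if_pos (Finset.mem_univ _), hrec _ i.isLt]
  have hi := i.isLt
  have e1 : (if 0 < i.val then h i.val else 0) + (if i.val = 0 then h 0 else 0) = h i.val := by
    rcases Nat.eq_zero_or_pos i.val with h0 | h0
    · simp [h0]
    · simp [h0, h0.ne']
  have e2 : (if i.val + 1 < K then h (i.val + 2) else 0) +
      (if i.val + 1 = K then h (K + 1) else 0) = h (i.val + 2) := by
    rcases Nat.lt_or_ge (i.val + 1) K with h0 | h0
    · simp [h0, h0.ne]
    · have h2 : i.val + 1 = K := by omega
      rw [if_neg (by omega), if_pos h2, zero_add]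
      exact congrArg h (by omega)
  linear_combination -e1 - e2

theorem chebQ_petal_solution (z : ℂ) (K : ℕ) : ∃ h : ℕ → ℂ,
    (∀ m < K, z * h (m + 1) = h m + h (m + 2)) ∧ h 0 = chebQ z K ∧ h (K + 1) = chebQ z K ∧
      (1 ≤ K → h 1 = chebQ z (K - 1) + 1 ∧ h K = chebQ z (K - 1) + 1) := by
  -- `q m` is `U_{m-1}(z / 2)`, with `U_{-1} = 0` set by hand since `0 - 1 = 0` in `ℕ`. The
  -- recurrence is invariant under `m ↦ K + 1 - m`, so `q` plus its reflection is a solution with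
  -- equal ends.
  let q : ℕ → ℂ := fun m => if m = 0 then 0 else chebQ z (m - 1)
  have hq : ∀ m, q (m + 2) = z * q (m + 1) - q m := by
    intro m
    rcases m with _ | m
    · simp [q, chebQ_zero, chebQ_one]
    · simp [q, chebQ_add_two]
  refine ⟨fun m => q m + q (K + 1 - m), fun m hm => ?_, ?_, ?_, fun hK => ⟨?_, ?_⟩⟩
  · obtain ⟨l, rfl⟩ : ∃ l, K = m + 1 + l := ⟨K - (m + 1), by omega⟩
    simp only [show m + 1 + l + 1 - (m + 1) = l + 1 by omega,
      show m + 1 + l + 1 - m = l + 2 by omega, show m + 1 + l + 1 - (m + 2) = l by omega, hq]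
    ring
  · simp [q]
  · simp [q]
  · simp [q, chebQ_zero, show K ≠ 0 by omega, add_comm]
  · simp [q, chebQ_zero, show K ≠ 0 by omega]

theorem det_blockDiagonal_sigma {ι : Type*} [Fintype ι] [LinearOrder ι] {m : ι → Type*}
    [∀ i, Fintype (m i)] [∀ i, DecidableEq (m i)] (M : ∀ i, Matrix (m i) (m i) ℂ) :
    (Matrix.blockDiagonal' M).det = ∏ i, (M i).det := by
  rw [(Matrix.blockTriangular_blockDiagonal' M).det_fintype]
  refine Finset.prod_congr rfl fun i _ => ?_
  let e : m i ≃ {a : Σ i, m i // a.1 = i} :=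
    Equiv.ofBijective (fun a => ⟨⟨i, a⟩, rfl⟩)
      ⟨fun a b h => by simpa using h, fun ⟨⟨i', a⟩, h⟩ => by
        subst h
        exact ⟨a, rfl⟩⟩
  rw [← Matrix.det_submatrix_equiv_self e]
  congr 1
  ext a b
  exact Matrix.blockDiagonal'_apply_eq M i a b

theorem flower_submatrix_eq_blockDiagonal {n : ℕ} {k : Fin n → ℕ} (hk : ∀ j, 2 ≤ k j) (z : ℂ)
    [DecidableRel (flower k).Adj] :
    (Matrix.scalar _ z - (flower k).adjMatrix ℂ).submatrix some some =
      Matrix.blockDiagonal' fun j => pathMatrix z (k j) := by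
  ext ⟨j, a⟩ ⟨j', b⟩
  by_cases h : j = j'
  · subst h
    rw [Matrix.blockDiagonal'_apply_eq]
    simp [pathMatrix, SimpleGraph.adjMatrix_apply, flower_adj_some_some hk, Matrix.diagonal_apply]
  · rw [Matrix.blockDiagonal'_apply_ne _ _ _ h]
    simp [SimpleGraph.adjMatrix_apply, flower_adj_some_some hk, h]

theorem graphCharpoly_flower_induce_eval {n : ℕ} {k : Fin n → ℕ} (hk : ∀ j, 2 ≤ k j) (z : ℂ) :
    (graphCharpoly ((flower k).induce {v | v ≠ none})).eval z = ∏ j, chebQ z (k j) := by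
  classical
  let e : (Σ j, Fin (k j)) ≃ {v : FlowerVertex k | v ≠ none} :=
    Equiv.ofBijective (fun a => ⟨some a, by simp⟩)
      ⟨fun a b h => by simpa using h, fun ⟨v, hv⟩ => by
        obtain ⟨a, rfl⟩ := Option.ne_none_iff_exists'.1 hv
        exact ⟨a, rfl⟩⟩
  rw [graphCharpoly_eval, ← Matrix.det_submatrix_equiv_self e,
    ← Finset.prod_congr rfl fun j _ => det_pathMatrix z (k j), ← det_blockDiagonal_sigma,
    ← flower_submatrix_eq_blockDiagonal hk z]
  congr 1
  ext a b
  have he : ∀ a, ((e a : {v : FlowerVertex k | v ≠ none}) : FlowerVertex k) = some a :=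
    fun _ => rfl
  simp [SimpleGraph.adjMatrix_apply, Matrix.diagonal_apply, he]

theorem graphCharpoly_flower_eval {n : ℕ} {k : Fin n → ℕ} (hk : ∀ j, 2 ≤ k j) (z : ℂ)
    (hz : ∀ j, chebQ z (k j) ≠ 0) :
    (graphCharpoly (flower k)).eval z =
      (∏ j, chebQ z (k j)) * (z - 2 * ∑ j, (chebQ z (k j - 1) + 1) / chebQ z (k j)) := by
  classical
  choose h hrec h0 hK hend using fun j => chebQ_petal_solution z (k j)
  rw [graphCharpoly_eval,
    -- The border column is `-1` at the ends of every petal. The boundary values of `h` are `chebQ z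
    -- (k j)`, hence the normalisation by `-1 / chebQ z (k j)`.
    det_bordered _ fun a => -h a.1 (a.2.val + 1) / chebQ z (k a.1)]
  · rw [flower_submatrix_eq_blockDiagonal hk z, det_blockDiagonal_sigma,
      Finset.prod_congr rfl fun j _ => det_pathMatrix z (k j)]
    congr 1
    have hentry : ∀ a : Σ j, Fin (k j),
        (Matrix.scalar (FlowerVertex k) z - (flower k).adjMatrix ℂ : Matrix _ _ ℂ) none (some a) *
          (-h a.1 (a.2.val + 1) / chebQ z (k a.1)) =
        (if a.2.val = 0 ∨ a.2.val + 1 = k a.1 then h a.1 (a.2.val + 1) else 0) /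
          chebQ z (k a.1) := by
      intro a
      simp [SimpleGraph.adjMatrix_apply, flower_adj_none_some hk]
      split_ifs <;> simp [neg_div]
    rw [Finset.sum_congr rfl fun a _ => hentry a, Fintype.sum_sigma, Finset.mul_sum]
    congr 1
    · simp [SimpleGraph.adjMatrix_apply]
    · refine Finset.sum_congr rfl fun j _ => ?_
      obtain ⟨e1, e2⟩ := hend j (by have := hk j; omega)
      change (∑ y : Fin (k j), (if y.val = 0 ∨ y.val + 1 = k j then h j (y.val + 1) else 0) /
        chebQ z (k j)) = _
      rw [← Finset.sum_div, sum_path_ends (hk j), e1, e2]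
      ring
  · rw [flower_submatrix_eq_blockDiagonal hk z]
    ext ⟨j, i⟩
    rw [Matrix.mulVec, dotProduct, Fintype.sum_sigma, Finset.sum_eq_single j]
    · have hentry : ∀ i' : Fin (k j),
          Matrix.blockDiagonal' (fun j => pathMatrix z (k j)) ⟨j, i⟩ ⟨j, i'⟩ *
            (-h j (i'.val + 1) / chebQ z (k j)) =
          pathMatrix z (k j) i i' * h j (i'.val + 1) * (-1 / chebQ z (k j)) := by
        intro i'
        rw [Matrix.blockDiagonal'_apply_eq]
        ring
      rw [Finset.sum_congr rfl fun i' _ => hentry i', ← Finset.sum_mul,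
        sum_pathMatrix_mul z (h j) (hrec j), h0, hK]
      have hz' := hz j
      have hkj := hk j
      simp only [Matrix.sub_apply, Matrix.scalar_apply, Matrix.diagonal_apply,
        SimpleGraph.adjMatrix_apply, SimpleGraph.adj_comm _ (some _) none,
        flower_adj_none_some hk, reduceCtorEq, if_false, zero_sub]
      by_cases hi0 : i.val = 0
      · have : ¬ i.val + 1 = k j := by omega
        simp [hi0, hz', show ¬ 1 = k j by omega, neg_div]
      · by_cases hi1 : i.val + 1 = k j
        · simp [hi0, hi1, hz', neg_div]
        · simp [hi0, hi1]
    · intro j' _ hj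
      refine Finset.sum_eq_zero fun i' _ => ?_
      rw [Matrix.blockDiagonal'_apply_ne _ _ _ hj.symm, zero_mul]
    · simp

/-! ### Adjacency operators -/

section AdjacencyOperator

variable {V : Type*} {G : SimpleGraph V} (hG : UniformlyLocallyFinite G)

theorem adjacencyOperator_apply (f : EllTwo V) (v : V) :
    adjacencyOperator G hG f v = ∑ u ∈ hG.nbrs v, f u := rfl

theorem adjacencyOperator_single [DecidableEq V] (v : V) :
    adjacencyOperator G hG (lp.single 2 v (1 : ℂ)) = ∑ u ∈ hG.nbrs v, lp.single 2 u (1 : ℂ) := by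
  ext w
  rw [adjacencyOperator_apply, lp.coeFn_sum, Finset.sum_apply]
  simp only [lp.single_apply, Finset.sum_pi_single]
  simp only [Pi.single_apply, Finset.sum_ite_eq']
  exact if_congr (by rw [hG.mem_nbrs, hG.mem_nbrs, G.adj_comm]) rfl rfl

theorem isSelfAdjoint_adjacencyOperator : IsSelfAdjoint (adjacencyOperator G hG) := by
  classical
  rw [ContinuousLinearMap.isSelfAdjoint_iff']
  ext f v
  have h := lp.inner_single_left (𝕜 := ℂ) v (1 : ℂ) (ContinuousLinearMap.adjoint (adjacencyOperator G hG) f)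
  rw [ContinuousLinearMap.adjoint_inner_right, adjacencyOperator_single, sum_inner] at h
  simp only [lp.inner_single_left, RCLike.inner_apply, map_one, mul_one] at h
  rw [← h, adjacencyOperator_apply]

/-- The number `hG.bound` is an unspecified choice; the comparison operator below needs the explicit
bound `2`. The proof is Cauchy–Schwarz and double counting of edges. -/
theorem norm_adjacencyOperator_le {D : ℕ} (hD : ∀ v, (hG.nbrs v).card ≤ D) :
    ‖adjacencyOperator G hG‖ ≤ D := by
  classical
  refine ContinuousLinearMap.opNorm_le_bound _ (Nat.cast_nonneg D) fun f => ?_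
  refine lp.norm_le_of_forall_sum_le (by norm_num) (by positivity) fun S => ?_
  have hf : ∀ T : Finset V, ∑ u ∈ T, ‖f u‖ ^ 2 ≤ ‖f‖ ^ 2 := by
    intro T
    have h := lp.sum_rpow_le_norm_rpow (p := 2) (by norm_num) f T
    simpa using h
  have h2 : (2 : ℝ≥0∞).toReal = ((2 : ℕ) : ℝ) := by norm_num
  simp only [h2, Real.rpow_natCast, adjacencyOperator_apply]
  calc ∑ v ∈ S, ‖∑ u ∈ hG.nbrs v, f u‖ ^ 2
      ≤ ∑ v ∈ S, D * ∑ u ∈ hG.nbrs v, ‖f u‖ ^ 2 := by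
        refine Finset.sum_le_sum fun v _ => ?_
        calc ‖∑ u ∈ hG.nbrs v, f u‖ ^ 2 ≤ (∑ u ∈ hG.nbrs v, ‖f u‖) ^ 2 := by
              gcongr
              exact norm_sum_le _ _
          _ ≤ (hG.nbrs v).card * ∑ u ∈ hG.nbrs v, ‖f u‖ ^ 2 := sq_sum_le_card_mul_sum_sq
          _ ≤ D * ∑ u ∈ hG.nbrs v, ‖f u‖ ^ 2 := by
              gcongr
              exact hD v
    _ = D * ∑ u ∈ S.biUnion hG.nbrs, ∑ v ∈ S with u ∈ hG.nbrs v, ‖f u‖ ^ 2 := by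
        rw [← Finset.mul_sum]
        refine congrArg _ (Finset.sum_comm' fun v u => ?_)
        simp only [Finset.mem_filter, Finset.mem_biUnion]
        exact ⟨fun h => ⟨h, v, h⟩, fun h => h.1⟩
    _ ≤ D * ∑ u ∈ S.biUnion hG.nbrs, D * ‖f u‖ ^ 2 := by
        gcongr with u hu
        rw [Finset.sum_const, nsmul_eq_mul]
        gcongr
        refine (Finset.card_le_card fun v hv => ?_).trans (hD u)
        rw [Finset.mem_filter, hG.mem_nbrs] at hv
        exact (hG.mem_nbrs _ _).2 hv.2.symm
    _ = D * (D * ∑ u ∈ S.biUnion hG.nbrs, ‖f u‖ ^ 2) := by rw [← Finset.mul_sum]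
    _ ≤ D * (D * ‖f‖ ^ 2) := by
        gcongr
        exact hf _
    _ = (D * ‖f‖) ^ 2 := by ring

end AdjacencyOperator

/-- A finite rank perturbation of an invertible operator is invertible once it is injective. -/
theorem isUnit_sub_of_finiteDimensional_range {E : Type*} [NormedAddCommGroup E] [NormedSpace ℂ E]
    [CompleteSpace E] {P K : E →L[ℂ] E} (hP : IsUnit P)
    [FiniteDimensional ℂ (LinearMap.range (K : E →ₗ[ℂ] E))]
    (hinj : ∀ x, P x = K x → x = 0) : IsUnit (P - K) := by
  rw [ContinuousLinearMap.isUnit_iff_bijective] at hP ⊢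
  refine ⟨(injective_iff_map_eq_zero (P - K)).2 fun x hx => hinj x (sub_eq_zero.1 hx), fun y => ?_⟩
  let e : E ≃ₗ[ℂ] E := LinearEquiv.ofBijective (P : E →ₗ[ℂ] E) hP
  have he : ∀ x, P (e.symm x) = x := fun x => e.apply_symm_apply x
  let W := LinearMap.range (K : E →ₗ[ℂ] E)
  -- `1 - K P⁻¹` maps the finite-dimensional range of `K` to itself; injective there, it is also
  -- surjective.
  let g : W →ₗ[ℂ] W := ((LinearMap.id : E →ₗ[ℂ] E) - (K : E →ₗ[ℂ] E) ∘ₗ e.symm.toLinearMap).restrict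
    fun x hx => W.sub_mem hx ⟨_, rfl⟩
  have hg : ∀ x : W, ((g x : W) : E) = x - K (e.symm x) := fun x => rfl
  have hginj : Function.Injective g := by
    refine (injective_iff_map_eq_zero g).2 fun x hx => ?_
    have h1 : (x : E) - K (e.symm x) = 0 := by rw [← hg, hx]; rfl
    have h2 := hinj (e.symm x) (by rw [he]; exact sub_eq_zero.1 h1)
    exact Subtype.ext ((map_eq_zero_iff e.symm e.symm.injective).1 h2)
  obtain ⟨u, hu⟩ := LinearMap.surjective_of_injective hginj ⟨K (e.symm y), ⟨_, rfl⟩⟩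
  have hu' : (u : E) - K (e.symm u) = K (e.symm y) := by rw [← hg, hu]
  refine ⟨e.symm y + e.symm u, ?_⟩
  rw [sub_apply, map_add, map_add, he, he, ← hu']
  abel

/-! ### The operator of the flower with a tail -/

/-- The value at the vertex number `m` of the `j`-th cycle, the root having the numbers `0` and
`k j + 1`. -/
def petalValue {n : ℕ} {k : Fin n → ℕ} (F : FlowerVertex k → ℂ) (j : Fin n) (m : ℕ) : ℂ :=
  if h : 1 ≤ m ∧ m ≤ k j then F (some ⟨j, ⟨m - 1, by omega⟩⟩) else F none

theorem petalValue_succ {n : ℕ} {k : Fin n → ℕ} (F : FlowerVertex k → ℂ) (p : Σ j, Fin (k j)) :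
    petalValue F p.1 (p.2.val + 1) = F (some p) := by
  have := p.2.isLt
  rw [petalValue, dif_pos (by omega)]
  rfl

theorem petalValue_zero {n : ℕ} {k : Fin n → ℕ} (F : FlowerVertex k → ℂ) (j : Fin n) :
    petalValue F j 0 = F none := by
  rw [petalValue, dif_neg (by omega)]

theorem petalValue_last {n : ℕ} {k : Fin n → ℕ} (F : FlowerVertex k → ℂ) (j : Fin n) :
    petalValue F j (k j + 1) = F none := by
  rw [petalValue, dif_neg (by omega)]

open Classical in
theorem sum_flower_neighbors_some {n : ℕ} {k : Fin n → ℕ} (hk : ∀ j, 2 ≤ k j)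
    (F : FlowerVertex k → ℂ) (p : Σ j, Fin (k j)) :
    (∑ u, if (flower k).Adj (some p) u then F u else 0) =
      petalValue F p.1 p.2.val + petalValue F p.1 (p.2.val + 2) := by
  obtain ⟨j, i⟩ := p
  rw [Fintype.sum_option, Fintype.sum_sigma, Finset.sum_eq_single j]
  · simp only [flower_adj_some_some hk, SimpleGraph.adj_comm _ (some _) none,
      flower_adj_none_some hk, true_and, ← petalValue_succ F]
    rw [sum_path_neighbors (petalValue F j) i]
    have hi := i.isLt
    have hkj := hk j
    by_cases h0 : i.val = 0
    · simp [h0, petalValue_zero, show 1 < k j by omega]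
    · by_cases h1 : i.val + 1 = k j
      · have : i.val + 2 = k j + 1 := by omega
        simp [h1, this, petalValue_last, Nat.pos_of_ne_zero h0, add_comm]
      · simp [h0, h1, Nat.pos_of_ne_zero h0, show i.val + 1 < k j by omega]
  · intro j' _ hj
    refine Finset.sum_eq_zero fun i' _ => if_neg ?_
    rw [flower_adj_some_some hk]
    exact fun h => hj h.1.symm
  · simp

open Classical in
theorem sum_flower_neighbors_none {n : ℕ} {k : Fin n → ℕ} (hk : ∀ j, 2 ≤ k j)
    (F : FlowerVertex k → ℂ) :
    (∑ u, if (flower k).Adj none u then F u else 0) =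
      ∑ j, (petalValue F j 1 + petalValue F j (k j)) := by
  rw [Fintype.sum_option, Fintype.sum_sigma]
  simp only [flower_adj_none_some hk, SimpleGraph.irrefl, if_false, zero_add, ← petalValue_succ F]
  exact Finset.sum_congr rfl fun j _ => sum_path_ends (hk j) (petalValue F j)

/-- The vertices of the tail, starting with the root of the flower. -/
def tailVertex {n : ℕ} (k : Fin n → ℕ) : ℕ → FlowerVertex k ⊕ ℕ
  | 0 => Sum.inl none
  | m + 1 => Sum.inr m

theorem tailVertex_ne_add_two {n : ℕ} (k : Fin n → ℕ) (m : ℕ) :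
    tailVertex k m ≠ tailVertex k (m + 2) := by
  rcases m with _ | m <;> simp [tailVertex]

open Classical in
theorem flowerWithTail_nbrs_inr {n : ℕ} (k : Fin n → ℕ) (m : ℕ) :
    (flowerWithTail_uniformlyLocallyFinite k).nbrs (Sum.inr m) =
      {tailVertex k m, tailVertex k (m + 2)} := by
  ext v
  rw [UniformlyLocallyFinite.mem_nbrs]
  rcases m with _ | m <;> rcases v with v | l <;>
    simp [flowerWithTail, coupling, infinitePath, SimpleGraph.edge_adj, tailVertex,
      SimpleGraph.hasse_adj, Order.covBy_iff_add_one_eq] <;> omega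

theorem flowerOperator_apply_inr {n : ℕ} {k : Fin n → ℕ} (f : EllTwo (FlowerVertex k ⊕ ℕ))
    (m : ℕ) : flowerOperator k f (Sum.inr m) = f (tailVertex k m) + f (tailVertex k (m + 2)) := by
  classical
  rw [flowerOperator, adjacencyOperator_apply, flowerWithTail_nbrs_inr,
    Finset.sum_pair (tailVertex_ne_add_two k m)]

open Classical in
theorem flowerOperator_apply_inl {n : ℕ} {k : Fin n → ℕ} (f : EllTwo (FlowerVertex k ⊕ ℕ))
    (v : FlowerVertex k) :
    flowerOperator k f (Sum.inl v) = (∑ u, if (flower k).Adj v u then f (Sum.inl u) else 0) +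
      if v = none then f (Sum.inr 0) else 0 := by
  rw [flowerOperator, adjacencyOperator_apply, ← Finset.sum_filter,
    show (∑ u with (flower k).Adj v u, f (Sum.inl u)) =
      ∑ u ∈ (Finset.univ.filter ((flower k).Adj v)).map Function.Embedding.inl, f u from
      (Finset.sum_map _ Function.Embedding.inl (fun u => f u)).symm]
  by_cases hv : v = none
  · rw [if_pos hv, add_comm, ← Finset.sum_insert (a := Sum.inr 0)]
    · refine Finset.sum_congr ?_ fun _ _ => rfl
      ext u
      rw [UniformlyLocallyFinite.mem_nbrs]
      rcases u with u | l <;>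
        simp [flowerWithTail, coupling, SimpleGraph.edge_adj, hv]
    · simp
  · rw [if_neg hv, add_zero]
    refine Finset.sum_congr ?_ fun _ _ => rfl
    ext u
    rw [UniformlyLocallyFinite.mem_nbrs]
    rcases u with u | l <;>
      simp [flowerWithTail, coupling, SimpleGraph.edge_adj, hv]

theorem flowerOperator_apply_some {n : ℕ} {k : Fin n → ℕ} (hk : ∀ j, 2 ≤ k j)
    (f : EllTwo (FlowerVertex k ⊕ ℕ)) (p : Σ j, Fin (k j)) :
    flowerOperator k f (Sum.inl (some p)) = petalValue (fun v => f (Sum.inl v)) p.1 p.2.val +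
      petalValue (fun v => f (Sum.inl v)) p.1 (p.2.val + 2) := by
  rw [flowerOperator_apply_inl, if_neg (by simp), add_zero,
    sum_flower_neighbors_some hk (fun v => f (Sum.inl v))]

theorem flowerOperator_apply_none {n : ℕ} {k : Fin n → ℕ} (hk : ∀ j, 2 ≤ k j)
    (f : EllTwo (FlowerVertex k ⊕ ℕ)) :
    flowerOperator k f (Sum.inl none) =
      (∑ j, (petalValue (fun v => f (Sum.inl v)) j 1 +
        petalValue (fun v => f (Sum.inl v)) j (k j))) + f (Sum.inr 0) := by
  rw [flowerOperator_apply_inl, if_pos rfl, sum_flower_neighbors_none hk (fun v => f (Sum.inl v))]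

/-! ### Invertibility outside of `[-2, 2]` -/

/-- Deleting the bridge and all flower edges leaves degrees at most `2`, so `z - B` is invertible.
The difference of the operators takes values supported on the flower and the first tail vertex, and
the Fredholm alternative applies. -/
theorem isUnit_sub_flowerOperator {n : ℕ} {k : Fin n → ℕ} {z : ℂ} (hz : 2 < ‖z‖)
    (hinj : ∀ f, flowerOperator k f = z • f → f = 0) :
    IsUnit (algebraMap ℂ (EllTwo (FlowerVertex k ⊕ ℕ) →L[ℂ] EllTwo (FlowerVertex k ⊕ ℕ)) z -
      flowerOperator k) := by
  classical
  let G : SimpleGraph (FlowerVertex k ⊕ ℕ) := (⊥ : SimpleGraph (FlowerVertex k)) ⊕g infinitePath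
  have hnbr : ∀ v, ∃ s : Finset (FlowerVertex k ⊕ ℕ), s.card ≤ 2 ∧ G.neighborSet v ⊆ s := by
    rintro (v | m)
    · refine ⟨∅, by simp, ?_⟩
      rintro (w | l) h <;> simp [G] at h
    · refine ⟨{Sum.inr (m + 1), Sum.inr (m - 1)}, Finset.card_le_two, ?_⟩
      rintro (w | l) h
      · simp [G] at h
      · simp [G, infinitePath, SimpleGraph.hasse_adj, Order.covBy_iff_add_one_eq] at h
        simp
        omega
  have hG : UniformlyLocallyFinite G := by
    refine ⟨2, fun v => ?_⟩
    obtain ⟨s, hs, hsub⟩ := hnbr v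
    refine ⟨s.finite_toSet.subset hsub, (Set.ncard_le_ncard hsub s.finite_toSet).trans ?_⟩
    rwa [Set.ncard_coe_finset]
  have hcard : ∀ v, (hG.nbrs v).card ≤ 2 := by
    intro v
    obtain ⟨s, hs, hsub⟩ := hnbr v
    exact (Finset.card_le_card fun u hu => hsub ((hG.mem_nbrs v u).1 hu)).trans hs
  set B := adjacencyOperator G hG with hB
  have hBunit : IsUnit (algebraMap ℂ _ z - B) := by
    refine spectrum.mem_resolventSet_of_norm_lt_mul ?_
    calc ‖B‖ * ‖(1 : EllTwo (FlowerVertex k ⊕ ℕ) →L[ℂ] EllTwo (FlowerVertex k ⊕ ℕ))‖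
        ≤ 2 * 1 := mul_le_mul (norm_adjacencyOperator_le hG hcard)
          ContinuousLinearMap.norm_id_le (norm_nonneg _) (by norm_num)
      _ < ‖z‖ := by linarith
  have hfar : ∀ f (m : ℕ), (flowerOperator k - B) f (Sum.inr (m + 1)) = 0 := by
    intro f m
    have h : B f (Sum.inr (m + 1)) = f (Sum.inr m) + f (Sum.inr (m + 2)) := by
      rw [hB, adjacencyOperator_apply,
        ← Finset.sum_pair (f := fun v => f v) (a := Sum.inr m) (b := Sum.inr (m + 2)) (by simp)]
      refine Finset.sum_congr ?_ fun _ _ => rfl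
      ext v
      rw [UniformlyLocallyFinite.mem_nbrs]
      rcases v with v | l <;>
        simp [G, infinitePath, SimpleGraph.hasse_adj, Order.covBy_iff_add_one_eq]
      omega
    rw [sub_apply, lp.coeFn_sub, Pi.sub_apply, h, flowerOperator_apply_inr]
    simp [tailVertex]
  let ρ : EllTwo (FlowerVertex k ⊕ ℕ) →ₗ[ℂ] (Option (FlowerVertex k) → ℂ) :=
    { toFun := fun f o => o.elim (f (Sum.inr 0)) fun v => f (Sum.inl v)
      map_add' := fun f g => by ext (_ | v) <;> simp
      map_smul' := fun c f => by ext (_ | v) <;> simp }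
  let K := flowerOperator k - B
  have hfin : FiniteDimensional ℂ (LinearMap.range
      (K : EllTwo (FlowerVertex k ⊕ ℕ) →ₗ[ℂ] EllTwo (FlowerVertex k ⊕ ℕ))) := by
    refine FiniteDimensional.of_injective (ρ ∘ₗ Submodule.subtype _)
      ((injective_iff_map_eq_zero _).2 ?_)
    rintro ⟨_, f, rfl⟩ hf
    refine Subtype.ext (lp.ext (funext ?_))
    rintro (v | _ | m)
    · exact congrFun hf (some v)
    · exact congrFun hf none
    · exact hfar f m
  have := isUnit_sub_of_finiteDimensional_range (K := K) hBunit fun f hf => hinj f ?_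
  · simpa [K] using this
  · have h : z • f - B f = flowerOperator k f - B f := hf
    exact (sub_left_injective h).symm

/-! ### The essential spectrum -/

/-- For the plane waves `g N` cut off on the tail, the image telescopes to four vectors of norm `1`,
while `‖g N‖ ^ 2 ≥ N`. No bounded inverse allows this. -/
theorem mem_spectrum_of_norm_eq_one {n : ℕ} (k : Fin n → ℕ) {w : ℂ} (hw : ‖w‖ = 1) :
    w + w⁻¹ ∈ spectrum ℂ (flowerOperator k) := by
  classical
  intro hu
  have hw0 : w ≠ 0 := by
    rintro rfl
    simp at hw
  obtain ⟨R, hR⟩ := hu.exists_left_inv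
  let e : ℕ → EllTwo (FlowerVertex k ⊕ ℕ) := fun m => lp.single 2 (tailVertex k m) 1
  have he : ∀ m, ‖e m‖ = 1 := fun m => by simp [e, lp.norm_single]
  have hA : ∀ m, flowerOperator k (e (m + 1)) = e m + e (m + 2) := by
    intro m
    change adjacencyOperator _ _ (lp.single 2 (Sum.inr m) 1) = _
    rw [adjacencyOperator_single, flowerWithTail_nbrs_inr,
      Finset.sum_pair (tailVertex_ne_add_two k m)]
  let g : ℕ → EllTwo (FlowerVertex k ⊕ ℕ) := fun N => ∑ m ∈ Finset.range N, w ^ m • e (m + 1)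
  have hg : ∀ N, (algebraMap ℂ (EllTwo (FlowerVertex k ⊕ ℕ) →L[ℂ] EllTwo (FlowerVertex k ⊕ ℕ))
      (w + w⁻¹) - flowerOperator k) (g N) =
      w⁻¹ • e 1 - e 0 + w ^ N • e N - (w ^ N * w⁻¹) • e (N + 1) := by
    intro N
    induction N with
    | zero => simp [g]
    | succ N ih =>
      have h1 : g (N + 1) = g N + w ^ N • e (N + 1) := Finset.sum_range_succ _ _
      rw [h1, map_add, ih, map_smul, sub_apply, hA,
        Algebra.algebraMap_eq_smul_one, smul_apply,
        one_apply_eq_self, pow_succ, mul_inv_cancel_right₀ hw0]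
      module
  have hgn : ∀ N : ℕ, (N : ℝ) ≤ ‖g N‖ ^ 2 := by
    intro N
    have h := lp.sum_rpow_le_norm_rpow (p := 2) (by norm_num) (g N)
      ((Finset.range N).map Function.Embedding.inr)
    have h2 : (2 : ℝ≥0∞).toReal = ((2 : ℕ) : ℝ) := by norm_num
    simp only [h2, Real.rpow_natCast, Finset.sum_map] at h
    refine le_trans (le_of_eq ?_) h
    have h3 : ∀ m ∈ Finset.range N, ‖g N (Function.Embedding.inr m)‖ ^ 2 = 1 := by
      intro m hm
      have : g N (Function.Embedding.inr m) = w ^ m := by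
        simp only [g, lp.coeFn_sum, Finset.sum_apply, lp.coeFn_smul, Pi.smul_apply, e]
        rw [Finset.sum_eq_single m]
        · simp [tailVertex]
        · intro l _ hl
          simp [tailVertex, hl.symm]
        · exact fun h => absurd hm h
      rw [this, norm_pow, hw]
      simp
    rw [Finset.sum_congr rfl h3]
    simp
  have hbound : ∀ N, ‖g N‖ ≤ ‖R‖ * 4 := by
    intro N
    have h1 : R ((algebraMap ℂ _ (w + w⁻¹) - flowerOperator k) (g N)) = g N := by
      rw [← mul_apply_eq_comp, hR, one_apply_eq_self]
    rw [← h1]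
    refine (R.le_opNorm _).trans (mul_le_mul_of_nonneg_left ?_ (norm_nonneg _))
    rw [hg]
    have t1 : ‖w⁻¹ • e 1‖ = 1 := by rw [norm_smul, he, norm_inv, hw]; norm_num
    have t2 : ‖w ^ N • e N‖ = 1 := by rw [norm_smul, he, norm_pow, hw]; norm_num
    have t3 : ‖(w ^ N * w⁻¹) • e (N + 1)‖ = 1 := by
      rw [norm_smul, he, norm_mul, norm_inv, norm_pow, hw]; norm_num
    have n1 := norm_sub_le (w⁻¹ • e 1 - e 0 + w ^ N • e N) ((w ^ N * w⁻¹) • e (N + 1))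
    have n2 := norm_add_le (w⁻¹ • e 1 - e 0) (w ^ N • e N)
    have n3 := norm_sub_le (w⁻¹ • e 1) (e 0)
    have := he 0
    linarith
  obtain ⟨N, hN⟩ := exists_nat_gt ((‖R‖ * 4) ^ 2)
  have := pow_le_pow_left₀ (norm_nonneg _) (hbound N) 2
  linarith [hgn N]

/-! ### Eigenvalues outside of `[-2, 2]` -/

/-- The quantity `w ^ m * (u (m + 1) - w * u m)` is independent of `m` and tends to `0` for bounded
`u`. So the growing solution `w⁻¹ ^ m` is absent. -/
theorem eq_pow_mul_of_bounded_of_rec {w : ℂ} (hw0 : w ≠ 0) (hw : ‖w‖ < 1) {u : ℕ → ℂ} {C : ℝ}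
    (hC : ∀ m, ‖u m‖ ≤ C) (hrec : ∀ m, u m + u (m + 2) = (w + w⁻¹) * u (m + 1)) (m : ℕ) :
    u m = w ^ m * u 0 := by
  have hd : ∀ m, w ^ m * (u (m + 1) - w * u m) = u 1 - w * u 0 := by
    intro m
    induction m with
    | zero => simp
    | succ m ih =>
      rw [← ih, pow_succ]
      have h := hrec m
      linear_combination (w ^ m * w) * h + w ^ m * u (m + 1) * mul_inv_cancel₀ hw0
  have hd0 : u 1 - w * u 0 = 0 := by
    have hbound : ∀ m : ℕ, ‖u 1 - w * u 0‖ ≤ ‖w‖ ^ m * (2 * C) := by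
      intro m
      rw [← hd m, norm_mul, norm_pow]
      gcongr
      have h1 := norm_sub_le (u (m + 1)) (w * u m)
      rw [norm_mul] at h1
      have h2 : ‖w‖ * ‖u m‖ ≤ 1 * C :=
        mul_le_mul hw.le (hC m) (norm_nonneg _) zero_le_one
      linarith [hC (m + 1)]
    have hlim := (tendsto_pow_atTop_nhds_zero_of_lt_one (norm_nonneg w) hw).mul_const (2 * C)
    rw [zero_mul] at hlim
    exact norm_le_zero_iff.1 (ge_of_tendsto' hlim hbound)
  induction m with
  | zero => simp
  | succ m ih =>
    have h := hd m
    rw [hd0] at h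
    have h' := (mul_eq_zero.1 h).resolve_left (pow_ne_zero _ hw0)
    rw [pow_succ]
    linear_combination h' + w * ih

theorem one_add_pow_succ_ne_zero {w : ℂ} (hw : ‖w‖ < 1) (K : ℕ) : 1 + w ^ (K + 1) ≠ 0 := by
  intro h
  have h1 : ‖w ^ (K + 1)‖ = 1 := by rw [eq_neg_of_add_eq_zero_right h, norm_neg, norm_one]
  rw [norm_pow] at h1
  exact absurd h1 (pow_lt_one₀ (norm_nonneg _) hw (by omega)).ne

theorem petal_recurrence_unique {w : ℂ} (hw0 : w ≠ 0) (hw : ‖w‖ < 1) {K : ℕ} {u : ℕ → ℂ} {c : ℂ}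
    (hrec : ∀ m < K, u m + u (m + 2) = (w + w⁻¹) * u (m + 1)) (h0 : u 0 = c)
    (hK : u (K + 1) = c) {m : ℕ} (hm : m ≤ K + 1) :
    u m = c * ((w ^ m + w ^ (K + 1 - m)) / (1 + w ^ (K + 1))) := by
  have hne := one_add_pow_succ_ne_zero hw K
  have hsq : ∀ l : ℕ, w ^ (l + 1) * w ^ (l + 1) ≠ 1 := by
    intro l h
    rw [← pow_add] at h
    have h1 : ‖w ^ (l + 1 + (l + 1))‖ = 1 := by rw [h, norm_one]
    rw [norm_pow] at h1
    exact absurd h1 (pow_lt_one₀ (norm_nonneg _) hw (by omega)).ne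
  -- The difference from the claimed solution, cleared of denominators: it satisfies the same
  -- recurrence with zero ends.
  let v : ℕ → ℂ := fun m => u m * (1 + w ^ (K + 1)) - c * (w ^ m + w ^ (K + 1 - m))
  have hv : ∀ m < K, v m + v (m + 2) = (w + w⁻¹) * v (m + 1) := by
    intro m hm
    obtain ⟨l, rfl⟩ : ∃ l, K = m + 1 + l := ⟨K - (m + 1), by omega⟩
    simp only [v, show m + 1 + l + 1 - (m + 1) = l + 1 by omega,
      show m + 1 + l + 1 - m = l + 2 by omega, show m + 1 + l + 1 - (m + 2) = l by omega]
    have h := hrec m hm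
    have hw1 := mul_inv_cancel₀ hw0
    simp only [pow_succ (n := m), pow_succ (n := m + 1), pow_succ (n := l),
      pow_succ (n := l + 1)]
    linear_combination (1 + w ^ (m + 1 + l + 1)) * h + c * (w ^ m + w ^ l) * hw1
  have hv0 : v 0 = 0 := by simp [v, h0]
  have hvK : v (K + 1) = 0 := by simp [v, hK]; ring
  -- This is `v m = v 1 * (w ^ m - w⁻¹ ^ m) / (w - w⁻¹)` multiplied out, at two consecutive indices
  -- for the induction. At `K + 1` it forces `v 1 = 0`.
  have hform : ∀ m ≤ K, w ^ (m + 1) * (v (m + 1) * (1 - w * w)) =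
      v 1 * w * (1 - w ^ (m + 1) * w ^ (m + 1)) ∧
      w ^ m * (v m * (1 - w * w)) = v 1 * w * (1 - w ^ m * w ^ m) := by
    intro m
    induction m with
    | zero => intro _; constructor <;> simp [hv0]; ring
    | succ m ih =>
      intro hm
      obtain ⟨ih1, ih2⟩ := ih (by omega)
      refine ⟨?_, ih1⟩
      have h := hv m (by omega)
      have hw1 := mul_inv_cancel₀ hw0
      simp only [pow_succ] at ih1 ih2 ⊢
      linear_combination (w ^ m * w * w * (1 - w * w)) * h - w * w * ih2 + (1 + w * w) * ih1 +
        w ^ m * w * (1 - w * w) * v (m + 1) * hw1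
  have hv1 : v 1 = 0 := by
    have h := (hform K le_rfl).1
    rw [hvK, zero_mul, mul_zero, eq_comm, mul_eq_zero] at h
    exact (mul_eq_zero.1 (h.resolve_right (sub_ne_zero.2 (hsq K).symm))).resolve_right hw0
  have hvm : v m = 0 := by
    rcases Nat.eq_zero_or_pos m with rfl | hpos
    · exact hv0
    · have h := (hform (m - 1) (by omega)).1
      rw [hv1, zero_mul, zero_mul, Nat.sub_add_cancel hpos] at h
      have h1 : 1 - w * w ≠ 0 := by simpa using sub_ne_zero.2 (hsq 0).symm
      exact (mul_eq_zero.1 ((mul_eq_zero.1 h).resolve_left (pow_ne_zero _ hw0))).resolve_right h1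
  rw [← mul_div_assoc, eq_div_iff hne]
  exact sub_eq_zero.1 hvm

/-- The solution of the eigenvalue equation off the root, with value `1` at the root. -/
noncomputable def flowerMode {n : ℕ} (k : Fin n → ℕ) (w : ℂ) : FlowerVertex k ⊕ ℕ → ℂ
  | Sum.inl none => 1
  | Sum.inl (some p) =>
      (w ^ (p.2.val + 1) + w ^ (k p.1 - p.2.val)) / (1 + w ^ (k p.1 + 1))
  | Sum.inr m => w ^ (m + 1)

/-- The value at the root determines an eigenvector, so eigenspaces off `[-2, 2]` have dimension at
most one. -/
theorem eq_mul_flowerMode {n : ℕ} {k : Fin n → ℕ} (hk : ∀ j, 2 ≤ k j) {w : ℂ} (hw0 : w ≠ 0)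
    (hw : ‖w‖ < 1) {f : EllTwo (FlowerVertex k ⊕ ℕ)} (hf : flowerOperator k f = (w + w⁻¹) • f)
    (v : FlowerVertex k ⊕ ℕ) : f v = f (Sum.inl none) * flowerMode k w v := by
  have hf' : ∀ v, flowerOperator k f v = (w + w⁻¹) * f v := fun v => by
    rw [hf, lp.coeFn_smul, Pi.smul_apply, smul_eq_mul]
  rcases v with (_ | p) | m
  · simp [flowerMode]
  · have hp := p.2.isLt
    rw [← petalValue_succ (fun v => f (Sum.inl v)) p,
      petal_recurrence_unique (K := k p.1) (u := petalValue (fun v => f (Sum.inl v)) p.1) hw0 hw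
        (fun m hm => ?_) (petalValue_zero _ _) (petalValue_last _ _) (by omega), flowerMode,
      show k p.1 + 1 - (p.2.val + 1) = k p.1 - p.2.val by omega]
    have h := flowerOperator_apply_some hk f ⟨p.1, ⟨m, hm⟩⟩
    rw [hf'] at h
    rw [← h, ← petalValue_succ (fun v => f (Sum.inl v)) ⟨p.1, ⟨m, hm⟩⟩]
  · have h := eq_pow_mul_of_bounded_of_rec hw0 hw (u := fun m => f (tailVertex k m)) (C := ‖f‖)
      (fun m => lp.norm_apply_le_norm (by norm_num) f _)
      (fun m => by rw [← flowerOperator_apply_inr, hf']; rfl) (m + 1)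
    rw [mul_comm]
    exact h

theorem memℓp_flowerMode {n : ℕ} (k : Fin n → ℕ) {w : ℂ} (hw : ‖w‖ < 1) :
    Memℓp (flowerMode k w) 2 := by
  refine memℓp_gen ?_
  refine Summable.sum (f := fun v => ‖flowerMode k w v‖ ^ (2 : ℝ≥0∞).toReal) ?_ ?_
  · exact Summable.of_finite
  · have h2 : (2 : ℝ≥0∞).toReal = ((2 : ℕ) : ℝ) := by norm_num
    have h : ((fun v => ‖flowerMode k w v‖ ^ (2 : ℝ≥0∞).toReal) ∘ Sum.inr) =
        fun m : ℕ => (‖w‖ ^ 2) ^ m * ‖w‖ ^ 2 := by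
      ext m
      simp only [Function.comp_apply, flowerMode, h2, Real.rpow_natCast, norm_pow]
      ring
    rw [h]
    exact (summable_geometric_of_lt_one (by positivity)
      (pow_lt_one₀ (norm_nonneg _) hw two_ne_zero)).mul_right _

theorem petalValue_flowerMode {n : ℕ} {k : Fin n → ℕ} {w : ℂ} (hw : ‖w‖ < 1) (j : Fin n) {m : ℕ}
    (hm : m ≤ k j + 1) : petalValue (fun v => flowerMode k w (Sum.inl v)) j m =
      (w ^ m + w ^ (k j + 1 - m)) / (1 + w ^ (k j + 1)) := by
  have hne := one_add_pow_succ_ne_zero hw (k j)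
  rcases Nat.eq_zero_or_pos m with rfl | h0
  · rw [petalValue_zero]
    simp [flowerMode, hne]
  · rcases hm.eq_or_lt with rfl | hm
    · rw [petalValue_last]
      simp [flowerMode, add_comm _ (1 : ℂ), hne]
    · have h := petalValue_succ (fun v => flowerMode k w (Sum.inl v)) ⟨j, ⟨m - 1, by omega⟩⟩
      simp only [Nat.sub_add_cancel h0] at h
      rw [h]
      simp only [flowerMode, Nat.sub_add_cancel h0]
      rw [show k j - (m - 1) = k j + 1 - m by omega]

/-- This is the eigenvalue equation at the root. The first tail vertex contributes `w`, which
cancels; multiplying the rest by `w` gives the secular form. -/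
theorem flowerMode_root_iff {n : ℕ} {k : Fin n → ℕ} {w : ℂ} (hw0 : w ≠ 0) (hw : ‖w‖ < 1) :
    (∑ j, (petalValue (fun v => flowerMode k w (Sum.inl v)) j 1 +
        petalValue (fun v => flowerMode k w (Sum.inl v)) j (k j))) + w = w + w⁻¹ ↔
      2 * ∑ j, (1 - (1 - w ^ 2) / (1 + w ^ (k j + 1))) = 1 := by
  have h : ∀ j, w * (petalValue (fun v => flowerMode k w (Sum.inl v)) j 1 +
      petalValue (fun v => flowerMode k w (Sum.inl v)) j (k j)) =
      2 * (1 - (1 - w ^ 2) / (1 + w ^ (k j + 1))) := by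
    intro j
    have hne := one_add_pow_succ_ne_zero hw (k j)
    rw [petalValue_flowerMode hw j (by omega), petalValue_flowerMode hw j (by omega),
      Nat.add_sub_cancel, Nat.add_sub_cancel_left]
    field_simp
    ring
  rw [add_comm w, add_left_inj, Finset.mul_sum, ← Finset.sum_congr rfl fun j _ => h j,
    ← Finset.mul_sum]
  exact ⟨fun h => by rw [h, mul_inv_cancel₀ hw0], fun h => eq_inv_of_mul_eq_one_right h⟩

theorem flowerOperator_eigenvector_iff {n : ℕ} {k : Fin n → ℕ} (hk : ∀ j, 2 ≤ k j) {w : ℂ}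
    (hw0 : w ≠ 0) (hw : ‖w‖ < 1) :
    (∃ f, f ≠ 0 ∧ flowerOperator k f = (w + w⁻¹) • f) ↔
      2 * ∑ j, (1 - (1 - w ^ 2) / (1 + w ^ (k j + 1))) = 1 := by
  rw [← flowerMode_root_iff hw0 hw]
  let g : EllTwo (FlowerVertex k ⊕ ℕ) := ⟨flowerMode k w, memℓp_flowerMode k hw⟩
  have hg : ∀ v, g v = flowerMode k w v := fun _ => rfl
  have hroot : flowerOperator k g (Sum.inl none) =
      (∑ j, (petalValue (fun v => flowerMode k w (Sum.inl v)) j 1 +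
        petalValue (fun v => flowerMode k w (Sum.inl v)) j (k j))) + w := by
    rw [flowerOperator_apply_none hk]
    simp only [hg]
    simp [flowerMode]
  rw [← hroot]
  constructor
  · rintro ⟨f, hf0, hf⟩
    have hfg : f = f (Sum.inl none) • g := lp.ext (funext fun v => eq_mul_flowerMode hk hw0 hw hf v)
    have hc : f (Sum.inl none) ≠ 0 := fun h => hf0 (by rw [hfg, h, zero_smul])
    have hAg : flowerOperator k g = (w + w⁻¹) • g := by
      rw [hfg, map_smul, smul_comm] at hf
      exact smul_right_injective _ hc hf
    rw [hAg, lp.coeFn_smul, Pi.smul_apply, hg]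
    simp [flowerMode]
  · intro h
    refine ⟨g, fun h0 => ?_, lp.ext (funext ?_)⟩
    · have := hg (Sum.inl none)
      rw [h0] at this
      simp [flowerMode] at this
    · rintro ((_ | p) | m)
      · rw [h, lp.coeFn_smul, Pi.smul_apply, hg]
        simp [flowerMode]
      · have hp := p.2.isLt
        obtain ⟨l, hl⟩ : ∃ l, k p.1 = p.2.val + 1 + l := ⟨k p.1 - (p.2.val + 1), by omega⟩
        rw [flowerOperator_apply_some hk, lp.coeFn_smul, Pi.smul_apply]
        simp only [hg, smul_eq_mul]
        rw [petalValue_flowerMode hw _ (by omega), petalValue_flowerMode hw _ (by omega), flowerMode,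
          show k p.1 + 1 - p.2.val = l + 2 by omega,
          show k p.1 + 1 - (p.2.val + 2) = l by omega, show k p.1 - p.2.val = l + 1 by omega,
          ← add_div, mul_div_assoc']
        congr 1
        simp only [pow_succ]
        linear_combination (-(w ^ p.2.val + w ^ l)) * mul_inv_cancel₀ hw0
      · rw [flowerOperator_apply_inr, lp.coeFn_smul, Pi.smul_apply]
        simp only [hg, smul_eq_mul]
        have ht : ∀ m, flowerMode k w (tailVertex k m) = w ^ m := by
          rintro (_ | m) <;> simp [tailVertex, flowerMode]
        rw [ht, ht, flowerMode, pow_succ, pow_succ]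
        linear_combination (-w ^ m) * mul_inv_cancel₀ hw0

theorem finiteDimensional_eigenspace_flowerOperator {n : ℕ} {k : Fin n → ℕ} (hk : ∀ j, 2 ≤ k j)
    {w : ℂ} (hw0 : w ≠ 0) (hw : ‖w‖ < 1) :
    FiniteDimensional ℂ (Module.End.eigenspace
      (flowerOperator k : Module.End ℂ (EllTwo (FlowerVertex k ⊕ ℕ))) (w + w⁻¹)) := by
  let ρ : EllTwo (FlowerVertex k ⊕ ℕ) →ₗ[ℂ] ℂ :=
    { toFun := fun f => f (Sum.inl none)
      map_add' := fun f g => rfl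
      map_smul' := fun c f => rfl }
  refine FiniteDimensional.of_injective (ρ ∘ₗ Submodule.subtype _)
    ((injective_iff_map_eq_zero _).2 ?_)
  rintro ⟨f, hf⟩ h0
  rw [Module.End.mem_eigenspace_iff] at hf
  refine Subtype.ext (lp.ext (funext fun v => ?_))
  rw [eq_mul_flowerMode hk hw0 hw hf v]
  exact (congrArg (· * _) h0).trans (zero_mul _)

/-! ### The hyperbolic equations, the spectrum and the discrete spectrum -/

theorem two_cosh_eq_add_inv {σ : ℝ} (hσ : σ = 1 ∨ σ = -1) {t : ℝ} (ht : 0 < t) :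
    ((σ * (2 * Real.cosh t) : ℝ) : ℂ) = ((σ * Real.exp (-t) : ℝ) : ℂ) +
      ((σ * Real.exp (-t) : ℝ) : ℂ)⁻¹ ∧
    ((σ * Real.exp (-t) : ℝ) : ℂ) ≠ 0 ∧ ‖((σ * Real.exp (-t) : ℝ) : ℂ)‖ < 1 := by
  have hx : Real.exp (-t) < 1 := Real.exp_lt_one_iff.2 (by linarith)
  have hσ2 : σ ^ 2 = 1 := by rcases hσ with rfl | rfl <;> norm_num
  have hσ0 : σ ≠ 0 := by rcases hσ with rfl | rfl <;> norm_num
  have hz : ((σ * (2 * Real.cosh t) : ℝ) : ℂ) = ((σ * Real.exp (-t) : ℝ) : ℂ) +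
      ((σ * Real.exp (-t) : ℝ) : ℂ)⁻¹ := by
    rw [← Complex.ofReal_inv, ← Complex.ofReal_add]
    congr 1
    rw [Real.cosh_eq, mul_inv, ← Real.exp_neg, neg_neg, ← eq_inv_of_mul_eq_one_left
      (show σ * σ = 1 by rw [← sq, hσ2])]
    ring
  have hw0 : ((σ * Real.exp (-t) : ℝ) : ℂ) ≠ 0 :=
    Complex.ofReal_ne_zero.2 (mul_ne_zero hσ0 (Real.exp_pos _).ne')
  have hw : ‖((σ * Real.exp (-t) : ℝ) : ℂ)‖ < 1 := by
    have h1 : |σ| = 1 := by rcases hσ with rfl | rfl <;> simp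
    rwa [Complex.norm_real, Real.norm_eq_abs, abs_mul, h1, one_mul, Real.abs_exp]
  exact ⟨hz, hw0, hw⟩

/-- With `w = σ * exp (-t)` the sign survives only in `w ^ (k j + 1)`, which is why one secular
equation yields both hyperbolic ones. -/
theorem exists_eigenvector_iff_sinh_equation {n : ℕ} {k : Fin n → ℕ} (hk : ∀ j, 2 ≤ k j) {σ : ℝ}
    (hσ : σ = 1 ∨ σ = -1) {t : ℝ} (ht : 0 < t) :
    (∃ f, f ≠ 0 ∧ flowerOperator k f = ((σ * (2 * Real.cosh t) : ℝ) : ℂ) • f) ↔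
      2 * ∑ j, (Real.sinh (k j * t) + σ ^ (k j + 1) * Real.sinh t) / Real.sinh ((k j + 1) * t) =
        Real.exp t := by
  have he : ∀ j, σ ^ (k j + 1) = 1 ∨ σ ^ (k j + 1) = -1 := by
    intro j
    rcases hσ with rfl | rfl
    · exact Or.inl (one_pow _)
    · exact neg_one_pow_eq_or ℝ _
  have hσ2 : σ ^ 2 = 1 := by rcases hσ with rfl | rfl <;> norm_num
  obtain ⟨hz, hw0, hw⟩ := two_cosh_eq_add_inv hσ ht
  rw [hz, flowerOperator_eigenvector_iff hk hw0 hw, secular_eq_iff k hk _ he ht, secular]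
  simp only [← Complex.ofReal_pow, mul_pow, hσ2, one_mul]
  norm_cast

theorem finiteDimensional_eigenspace_two_cosh {n : ℕ} {k : Fin n → ℕ} (hk : ∀ j, 2 ≤ k j) {σ : ℝ}
    (hσ : σ = 1 ∨ σ = -1) {t : ℝ} (ht : 0 < t) :
    FiniteDimensional ℂ (Module.End.eigenspace
      (flowerOperator k : Module.End ℂ (EllTwo (FlowerVertex k ⊕ ℕ)))
        ((σ * (2 * Real.cosh t) : ℝ) : ℂ)) := by
  obtain ⟨hz, hw0, hw⟩ := two_cosh_eq_add_inv hσ ht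
  rw [hz]
  exact finiteDimensional_eigenspace_flowerOperator hk hw0 hw

theorem mem_spectrum_of_eigenvector {E : Type*} [NormedAddCommGroup E] [NormedSpace ℂ E]
    {T : E →L[ℂ] E} {z : ℂ} {f : E} (hf0 : f ≠ 0) (hf : T f = z • f) : z ∈ spectrum ℂ T := by
  intro hu
  obtain ⟨R, hR⟩ := hu.exists_left_inv
  have h1 : R ((algebraMap ℂ (E →L[ℂ] E) z - T) f) = f := by
    rw [← mul_apply_eq_comp, hR, one_apply_eq_self]
  have h2 : (algebraMap ℂ (E →L[ℂ] E) z - T) f = 0 := by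
    rw [sub_apply, hf, Algebra.algebraMap_eq_smul_one, smul_apply, one_apply_eq_self, sub_self]
  rw [h2, map_zero] at h1
  exact hf0 h1.symm

theorem ofReal_mem_spectrum_flowerOperator {n : ℕ} (k : Fin n → ℕ) {s : ℝ}
    (hs : s ∈ Set.Icc (-2 : ℝ) 2) : (s : ℂ) ∈ spectrum ℂ (flowerOperator k) := by
  have h := mem_spectrum_of_norm_eq_one k (Complex.norm_exp_ofReal_mul_I (Real.arccos (s / 2)))
  rw [← Complex.exp_neg, ← neg_mul, ← Complex.two_cos, ← Complex.ofReal_cos,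
    Real.cos_arccos (by linarith [hs.1]) (by linarith [hs.2])] at h
  convert h using 1
  push_cast
  ring

theorem spectrum_flowerOperator_eq {n : ℕ} {k : Fin n → ℕ} (hk : ∀ j, 2 ≤ k j) :
    spectrum ℂ (flowerOperator k) = Complex.ofReal '' (Set.Icc (-2 : ℝ) 2 ∪
      {s | ∃ σ t : ℝ, (σ = 1 ∨ σ = -1) ∧ 0 < t ∧ s = σ * (2 * Real.cosh t) ∧
        2 * ∑ j, (Real.sinh (k j * t) + σ ^ (k j + 1) * Real.sinh t) / Real.sinh ((k j + 1) * t) =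
          Real.exp t}) := by
  ext z
  constructor
  · intro hz
    have hre : z = z.re :=
      (isSelfAdjoint_adjacencyOperator (flowerWithTail_uniformlyLocallyFinite k)).mem_spectrum_eq_re
        hz
    refine ⟨z.re, ?_, hre.symm⟩
    by_cases hs : |z.re| ≤ 2
    · exact Or.inl (abs_le.1 hs)
    · rw [not_le] at hs
      obtain ⟨f, hf, hf0⟩ : ∃ f, flowerOperator k f = z • f ∧ f ≠ 0 := by
        by_contra! hno
        exact hz (isUnit_sub_flowerOperator (by rwa [hre, Complex.norm_real]) hno)
      have ht : 0 < Real.arcosh (|z.re| / 2) := Real.arcosh_pos (by linarith)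
      have hcosh : 2 * Real.cosh (Real.arcosh (|z.re| / 2)) = |z.re| := by
        rw [Real.cosh_arcosh (by linarith)]
        ring
      have main : ∀ σ : ℝ, (σ = 1 ∨ σ = -1) → z.re = σ * |z.re| →
          z.re ∈ {s | ∃ σ t : ℝ, (σ = 1 ∨ σ = -1) ∧ 0 < t ∧ s = σ * (2 * Real.cosh t) ∧
            2 * ∑ j, (Real.sinh (k j * t) + σ ^ (k j + 1) * Real.sinh t) /
              Real.sinh ((k j + 1) * t) = Real.exp t} := by
        intro σ hσ h
        refine ⟨σ, _, hσ, ht, by rw [hcosh, ← h], ?_⟩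
        rw [← exists_eigenvector_iff_sinh_equation hk hσ ht, hcosh, ← h, ← hre]
        exact ⟨f, hf0, hf⟩
      refine Or.inr ?_
      rcases abs_cases z.re with ⟨h, -⟩ | ⟨h, -⟩
      · exact main 1 (Or.inl rfl) (by rw [h, one_mul])
      · exact main (-1) (Or.inr rfl) (by rw [h]; ring)
  · rintro ⟨s, hs | ⟨σ, t, hσ, ht, rfl, heq⟩, rfl⟩
    · exact ofReal_mem_spectrum_flowerOperator k hs
    · obtain ⟨f, hf0, hf⟩ := (exists_eigenvector_iff_sinh_equation hk hσ ht).2 heq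
      exact mem_spectrum_of_eigenvector hf0 hf

theorem discreteSpectrum_eq_of_spectrum_eq {E : Type*} [NormedAddCommGroup E] [NormedSpace ℂ E]
    {T : E →L[ℂ] E} {a b : ℝ} (ha : 2 < a) (hb : b < -2)
    (hT : spectrum ℂ T = Complex.ofReal '' (Set.Icc (-2 : ℝ) 2 ∪ {a, b}))
    (heig : ∀ c ∈ ({a, b} : Set ℝ), (∃ f, f ≠ 0 ∧ T f = (c : ℂ) • f) ∧
      FiniteDimensional ℂ (Module.End.eigenspace (T : Module.End ℂ E) (c : ℂ))) :
    discreteSpectrum T = Complex.ofReal '' {a, b} := by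
  ext z
  constructor
  · rintro ⟨⟨ε, hε, hiso⟩, heigz, -⟩
    obtain ⟨f, hf, hf0⟩ := heigz.exists_hasEigenvector
    have hz : z ∈ spectrum ℂ T :=
      mem_spectrum_of_eigenvector hf0 (Module.End.mem_eigenspace_iff.1 hf)
    rw [hT] at hz hiso
    obtain ⟨s, hs | hs, rfl⟩ := hz
    · exfalso
      -- A step of this length towards the far end of the interval stays in `[-2, 2]` and within
      -- `ε`, so no point there is isolated.
      have hδ : 0 < min (ε / 2) 1 := by positivity
      have h1 : min (ε / 2) 1 ≤ ε / 2 := min_le_left _ _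
      have h2 : min (ε / 2) 1 ≤ 1 := min_le_right _ _
      have key : ∀ r : ℝ, r ∈ Set.Icc (-2 : ℝ) 2 → |r - s| < ε → r = s := by
        intro r hr hrs
        refine Complex.ofReal_injective (hiso r ⟨r, Or.inl hr, rfl⟩ ?_)
        rwa [Complex.dist_of_im_eq (by simp), Complex.ofReal_re, Complex.ofReal_re,
          Real.dist_eq]
      rcases le_total s 0 with h0 | h0
      · have := key (s + min (ε / 2) 1) ⟨by linarith [hs.1], by linarith⟩
          (by rw [abs_lt]; constructor <;> linarith)
        linarith
      · have := key (s - min (ε / 2) 1) ⟨by linarith, by linarith [hs.2]⟩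
          (by rw [abs_lt]; constructor <;> linarith)
        linarith
    · exact ⟨s, hs, rfl⟩
  · rintro ⟨c, hc, rfl⟩
    obtain ⟨⟨f, hf0, hf⟩, hfd⟩ := heig c hc
    -- The radius is the distance from `c` to `[-2, 2]`; the other exceptional point lies beyond
    -- that interval.
    refine ⟨⟨|c| - 2, ?_, ?_⟩, Module.End.hasEigenvalue_of_hasEigenvector
      ⟨Module.End.mem_eigenspace_iff.2 hf, hf0⟩, hfd⟩
    · rcases hc with rfl | rfl
      · linarith [le_abs_self c]
      · linarith [neg_le_abs c]
    · rw [hT]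
      rintro _ ⟨r, hr, rfl⟩ hd
      rw [Complex.dist_of_im_eq (by simp), Complex.ofReal_re, Complex.ofReal_re, Real.dist_eq] at hd
      refine congrArg _ ?_
      obtain ⟨hd1, hd2⟩ := abs_lt.1 hd
      rcases hc with rfl | rfl
      · rw [abs_of_pos (by linarith)] at hd1 hd2
        rcases hr with hr | rfl | rfl
        · linarith [hr.2]
        · rfl
        · linarith
      · rw [abs_of_neg (by linarith)] at hd1 hd2
        rcases hr with hr | rfl | rfl
        · linarith [hr.1]
        · linarith
        · rfl

theorem spectrum_and_discreteSpectrum_flowerOperator {n : ℕ} (hn : 2 ≤ n) {k : Fin n → ℕ}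
    (hk : ∀ j, 2 ≤ k j) {tp tm : ℝ} (hp0 : 0 < tp)
    (hp : 2 * ∑ j, (Real.sinh (k j * tp) + 1 ^ (k j + 1) * Real.sinh tp) /
      Real.sinh ((k j + 1) * tp) = Real.exp tp)
    (hm0 : 0 < tm)
    (hm : 2 * ∑ j, (Real.sinh (k j * tm) + (-1) ^ (k j + 1) * Real.sinh tm) /
      Real.sinh ((k j + 1) * tm) = Real.exp tm) :
    spectrum ℂ (flowerOperator k) =
        (Complex.ofReal '' (Set.Icc (-2 : ℝ) 2 ∪ {2 * Real.cosh tp, -2 * Real.cosh tm})) ∧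
      discreteSpectrum (flowerOperator k) =
        (Complex.ofReal '' {2 * Real.cosh tp, -2 * Real.cosh tm}) := by
  have hspec : spectrum ℂ (flowerOperator k) =
      (Complex.ofReal '' (Set.Icc (-2 : ℝ) 2 ∪ {2 * Real.cosh tp, -2 * Real.cosh tm})) := by
    rw [spectrum_flowerOperator_eq hk]
    congr 2
    ext s
    constructor
    · rintro ⟨σ, t, rfl | rfl, ht, rfl, heq⟩
      · rw [(existsUnique_sinh_equation hn k hk _ fun j => Or.inl (one_pow (k j + 1))).unique
          ⟨ht, heq⟩ ⟨hp0, hp⟩, one_mul]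
        exact Or.inl rfl
      · rw [(existsUnique_sinh_equation hn k hk _ fun j =>
          neg_one_pow_eq_or ℝ (k j + 1)).unique ⟨ht, heq⟩ ⟨hm0, hm⟩]
        exact Or.inr (by simp)
    · rintro (rfl | rfl)
      · exact ⟨1, tp, Or.inl rfl, hp0, by ring, hp⟩
      · exact ⟨-1, tm, Or.inr rfl, hm0, by ring, hm⟩
  refine ⟨hspec, discreteSpectrum_eq_of_spectrum_eq ?_ ?_ hspec ?_⟩
  · linarith [Real.one_lt_cosh.2 hp0.ne']
  · linarith [Real.one_lt_cosh.2 hm0.ne']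
  · rintro c (rfl | rfl)
    · rw [← one_mul (2 * Real.cosh tp)]
      exact ⟨(exists_eigenvector_iff_sinh_equation hk (Or.inl rfl) hp0).2 hp,
        finiteDimensional_eigenspace_two_cosh hk (Or.inl rfl) hp0⟩
    · rw [show -2 * Real.cosh tm = -1 * (2 * Real.cosh tm) by ring]
      exact ⟨(exists_eigenvector_iff_sinh_equation hk (Or.inr rfl) hm0).2 hm,
        finiteDimensional_eigenspace_two_cosh hk (Or.inr rfl) hm0⟩

theorem mainTheorem6 (n : ℕ) (hn : 2 ≤ n) (k : Fin n → ℕ) (hk : ∀ j, 2 ≤ k j) :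
    (∃! t : ℝ, 0 < t ∧
      2 * ∑ j, (Real.sinh (k j * t) + Real.sinh t) / Real.sinh ((k j + 1) * t) = Real.exp t) ∧
    (∃! t : ℝ, 0 < t ∧
      2 * ∑ j, (Real.sinh (k j * t) + (-1) ^ (k j + 1) * Real.sinh t) /
        Real.sinh ((k j + 1) * t) = Real.exp t) ∧
    (∀ tp tm : ℝ, 0 < tp →
      2 * ∑ j, (Real.sinh (k j * tp) + Real.sinh tp) / Real.sinh ((k j + 1) * tp)
        = Real.exp tp →
      0 < tm →
      2 * ∑ j, (Real.sinh (k j * tm) + (-1) ^ (k j + 1) * Real.sinh tm) /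
        Real.sinh ((k j + 1) * tm) = Real.exp tm →
      spectrum ℂ (flowerOperator k) =
        (Complex.ofReal '' (Set.Icc (-2 : ℝ) 2 ∪ {2 * Real.cosh tp, -2 * Real.cosh tm})) ∧
      discreteSpectrum (flowerOperator k) =
        (Complex.ofReal '' {2 * Real.cosh tp, -2 * Real.cosh tm})) ∧
    (discreteSpectrum (flowerOperator k)).ncard = 2 ∧
    (∀ (m : ℕ) (z : ℂ), (graphCharpoly (SimpleGraph.pathGraph m)).eval z = chebQ z m) ∧
    (∀ z : ℂ, (graphCharpoly ((flower k).induce {v | v ≠ none})).eval z = ∏ j, chebQ z (k j)) ∧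
    (∀ z : ℂ, (∀ j, chebQ z (k j) ≠ 0) →
      (graphCharpoly (flower k)).eval z =
        (∏ j, chebQ z (k j)) *
          (z - 2 * ∑ j, (chebQ z (k j - 1) + 1) / chebQ z (k j))) := by
  have hplus := existsUnique_sinh_equation hn k hk _ fun j => Or.inl (one_pow (k j + 1))
  have hminus := existsUnique_sinh_equation hn k hk _ fun j => neg_one_pow_eq_or ℝ (k j + 1)
  refine ⟨by simpa only [one_pow, one_mul] using hplus, hminus, fun tp tm hp0 hp hm0 hm =>
    spectrum_and_discreteSpectrum_flowerOperator hn hk hp0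
      (by simpa only [one_pow, one_mul] using hp) hm0 hm, ?_, graphCharpoly_pathGraph_eval,
    graphCharpoly_flower_induce_eval hk, graphCharpoly_flower_eval hk⟩
  obtain ⟨tp, ⟨hp0, hp⟩, -⟩ := hplus
  obtain ⟨tm, ⟨hm0, hm⟩, -⟩ := hminus
  rw [(spectrum_and_discreteSpectrum_flowerOperator hn hk hp0 hp hm0 hm).2,
    Set.ncard_image_of_injective _ Complex.ofReal_injective, Set.ncard_pair]
  linarith [Real.cosh_pos tp, Real.cosh_pos tm]
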